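/- Let $\mathcal O_K$ be a Henselian discrete valuation ring with fraction field $K$, normalized valuation $\nu_K$, and algebraically closed residue field of characteristic different from $2$. Let $K^{\mathrm{sep}}$ be a separable closure of $K$, and write $\nu_K$ also for the unique extension of $\nu_K$ to $K^{\mathrm{sep}}$. \textbf{Mac Lane valuations.} For a valuation $v$ on $K[x]$ extending $\nu_K$, write $f\sim_v g$ if $v(f)=v(g)<v(f-g)$, and $f\mid_v g$ if $g\sim_v fh$ for some $h\in K[x]$. A \emph{key polynomial} over $v$ is a monic nonconstant $\phi\in\mathcal O_K[x]$ such that $\phi\mid_v fg$ implies $\phi\mid_v f$ or $\phi\mid_v g$, and such that $\phi\mid_v f$ implies $\deg\phi\le\deg f$. Let $v_0$ be the Gauss valuation, $v_0(\sum a_ix^i)=\min_i\nu_K(a_i)$. A Mac Lane valuation of inductive length $n$, $$v_n=[v_0,\,v_1(\phi_1)=\lambda_1,\dots,v_n(\phi_n)=\lambda_n],$$ is given by $\phi_i\in\mathcal O_K[x]$ and $\lambda_i\in\mathbb Q$ such that for $1\le i\le n$ the polynomial $\phi_i$ is a key polynomial over $v_{i-1}$, $\lambda_i>v_{i-1}(\phi_i)$,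 and $v_i(\sum_j a_j\phi_i^j)=\min_j\bigl(v_{i-1}(a_j)+j\lambda_i\bigr)$ whenever $\deg a_j<\deg\phi_i$ for all $j$; the degrees $\deg\phi_i$ are required to be strictly increasing, each dividing the next. For $n\ge1$, a \emph{proper key polynomial} over $v_n$ is a key polynomial $f$ over $v_n$ with $\deg f>\deg\phi_n$. \textbf{Discriminant bonus.} For $\alpha\in K^{\mathrm{sep}}$ with (monic) minimal polynomial $f$ over $K$, put $$\mathrm{db}_K(\alpha)=\nu_K(\mathrm{disc} f)-\nu_K(\mathrm{disc}(K(\alpha)/K)),$$ where $\mathrm{disc}(K(\alpha)/K)$ is the discriminant of an $\mathcal O_K$-basis of the integral closure of $\mathcal O_K$ in $K(\alpha)$. \textbf{Proposition.} Let $\alpha\in K^{\mathrm{sep}}$ with $\nu_K(\alpha)>0$, let $f$ be its minimal polynomial over $K$, and let $v_f=[v_0,\,v_1(\phi_1)=\lambda_1,\dots,v_n(\phi_n)=\lambda_n]$ be the Mac Lane valuation over which $f$ is a proper key polynomial. Suppose $n\ge2$ and put $e=\deg(f)/\deg(\phi_n)$. Then $e\ge2$ and $$\mathrm{db}_K(\alpha)\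 \ge\ \begin{cases}2\deg(\phi_n)\lambda_n-1 & \text{if } e=2,\\[2pt] 2\bigl(\lfloor\deg(\phi_n)\lambda_n\rfloor+e-1\bigr) & \text{if } e>2.\end{cases}$$ If equality holds, then $e=n=2$ and $\phi_2$ is Eisenstein. -/

import Mathlib

open Polynomial IntermediateField

namespace MacLane

noncomputable section

section Field

variable (O : Type*) [CommRing O] [IsDomain O] [IsDiscreteValuationRing O]
variable {K : Type*} [Field K] [Algebra O K] [IsFractionRing O K]

/-- The normalized discrete valuation `K^× → ℤ` attached to the discrete valuation ring `O` with
fraction field `K`. It is only used at nonzero elements (its value at `0` is a dummy `0`). -/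
def ordInt (x : K) : ℤ :=
  -WithZero.log ((IsDiscreteValuationRing.maximalIdeal O).valuation K x)

open Classical in
/-- The normalized discrete valuation `ν_K : K → ℤ ∪ {∞}`, regarded as taking values in
`ℚ ∪ {∞}`. -/
def ord (x : K) : WithTop ℚ :=
  if x = 0 then ⊤ else ((ordInt O x : ℚ) : WithTop ℚ)

/-- The Gauss valuation: the minimum of the valuations of the coefficients. -/
def gauss (f : K[X]) : WithTop ℚ :=
  f.support.inf fun i => ord O (f.coeff i)

end Field

section Augmentation

variable {K : Type*} [Field K]

/-- The coefficient of `φ ^ i` in the `φ`-adic expansion of `f` (for `φ` monic, nonconstant). -/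
def digit (φ f : K[X]) (i : ℕ) : K[X] :=
  (f /ₘ φ ^ i) %ₘ φ

/-- The augmented valuation `[v, v'(φ) = lam]`, which sends `f = ∑ aᵢ φ ^ i` with
`deg aᵢ < deg φ` to the minimum of the `v(aᵢ) + i * lam`. -/
def augment (v : K[X] → WithTop ℚ) (φ : K[X]) (lam : ℚ) (f : K[X]) : WithTop ℚ :=
  (Finset.range (f.natDegree + 1)).inf fun i =>
    v (digit φ f i) + (((i : ℚ) * lam : ℚ) : WithTop ℚ)

/-- `v`-equivalence: `f` and `g` have the same initial term with respect to `v`. -/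
def VEquiv (v : K[X] → WithTop ℚ) (f g : K[X]) : Prop :=
  v f = v g ∧ v f < v (f - g)

/-- `v`-divisibility: `g` is `v`-equivalent to a multiple of `f`. -/
def VDvd (v : K[X] → WithTop ℚ) (f g : K[X]) : Prop :=
  ∃ h : K[X], VEquiv v g (f * h)

/-- Key polynomials over `v` (in the sense of Mac Lane): monic nonconstant polynomials with
integral coefficients that are `v`-irreducible and `v`-minimal. -/
structure IsKeyPoly (O : Type*) [CommRing O] [Algebra O K]
    (v : K[X] → WithTop ℚ) (φ : K[X]) : Prop where
  monic : φ.Monic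
  natDegree_pos : 0 < φ.natDegree
  integral : φ ∈ Polynomial.lifts (algebraMap O K)
  irreducible : ∀ f g : K[X], VDvd v φ (f * g) → VDvd v φ f ∨ VDvd v φ g
  minimal : ∀ f : K[X], VDvd v φ f → φ.natDegree ≤ f.natDegree

end Augmentation

section Inductive

variable (O : Type*) [CommRing O] [IsDomain O] [IsDiscreteValuationRing O]
variable {K : Type*} [Field K] [Algebra O K] [IsFractionRing O K]

/-- The truncation `v_i = [v_0, v_1(φ 1) = lam 1, …, v_i(φ i) = lam i]`.
Only the entries of `φ` and `lam` with index in `{1, …, i}` matter. -/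
def val (φ : ℕ → K[X]) (lam : ℕ → ℚ) : ℕ → K[X] → WithTop ℚ
  | 0 => gauss O
  | i + 1 => augment (val φ lam i) (φ (i + 1)) (lam (i + 1))

/-- `[v_0, v_1(φ 1) = lam 1, …, v_n(φ n) = lam n]` is a Mac Lane valuation, presented with key
polynomials of strictly increasing degrees; `n` is then its inductive valuation length. -/
structure IsMacLane (n : ℕ) (φ : ℕ → K[X]) (lam : ℕ → ℚ) : Prop where
  key : ∀ i < n, IsKeyPoly O (val O φ lam i) (φ (i + 1))
  val_lt : ∀ i < n, val O φ lam i (φ (i + 1)) < (lam (i + 1) : WithTop ℚ)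
  natDegree_dvd : ∀ i, 1 ≤ i → i < n → (φ i).natDegree ∣ (φ (i + 1)).natDegree
  natDegree_lt : ∀ i, 1 ≤ i → i < n → (φ i).natDegree < (φ (i + 1)).natDegree

/-- `f` is a proper key polynomial over `[v_0, …, v_n(φ n) = lam n]`. -/
def IsProperKeyPoly (n : ℕ) (φ : ℕ → K[X]) (lam : ℕ → ℚ) (f : K[X]) : Prop :=
  IsKeyPoly O (val O φ lam n) f ∧ (n = 0 ∨ (φ n).natDegree < f.natDegree)

/-- A polynomial over `K` that is monic with coefficients in `O` and Eisenstein at the maximal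
ideal of `O`. -/
def IsEisenstein (φ : K[X]) : Prop :=
  ∃ g : O[X], g.map (algebraMap O K) = φ ∧ g.Monic ∧
    g.IsEisensteinAt (IsLocalRing.maximalIdeal O)

end Inductive

section Discriminant

variable (O : Type*) [CommRing O] [IsDomain O] [IsDiscreteValuationRing O]
variable (K : Type*) [Field K] [Algebra O K] [IsFractionRing O K]

/-- The discriminant of a finite separable extension `L / K`: the discriminant of the trace form
on an `O`-basis of the integral closure of `O` in `L` (well defined up to squares of units of
`O`). -/
def fieldDiscr (L : Type*) [Field L] [Algebra K L] [Algebra O L] [IsScalarTower O K L]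
    [FiniteDimensional K L] [Algebra.IsSeparable K L] : K :=
  haveI : Module.Finite O (integralClosure O L) :=
    IsIntegralClosure.finite O K L (integralClosure O L)
  haveI : Module.IsTorsionFree O K := inferInstance
  haveI : Module.IsTorsionFree O L := Module.IsTorsionFree.trans_faithfulSMul O K L
  haveI : Module.Free O (integralClosure O L) :=
    IsIntegralClosure.module_free O K L (integralClosure O L)
  Algebra.discr K fun i =>
    ((Module.Free.chooseBasis O (integralClosure O L) i : integralClosure O L) : L)

/-- The discriminant bonus `db_K(α) = ν_K(disc f) - ν_K(disc(K(α)/K))`, where `f` is the minimal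
polynomial of `α` over `K`. -/
def discBonus {Ω : Type*} [Field Ω] [Algebra K Ω] [Algebra O Ω] [IsScalarTower O K Ω]
    [Algebra.IsSeparable K Ω] (α : Ω) : ℤ :=
  haveI : FiniteDimensional K K⟮α⟯ :=
    adjoin.finiteDimensional (Algebra.IsSeparable.isIntegral K α)
  haveI : Algebra.IsSeparable K K⟮α⟯ := inferInstance
  ordInt O (minpoly K α).discr - ordInt O (fieldDiscr O K K⟮α⟯)

/-- The lower bound for the discriminant bonus, in terms of `e = deg f / deg φ_n` and
`x = deg(φ_n) * λ_n`. -/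
def bonusBound (e x : ℚ) : ℚ :=
  if e = 2 then 2 * x - 1 else 2 * ((⌊x⌋ : ℚ) + e - 1)

end Discriminant

end

end MacLane

/-!
Since the residue field is algebraically closed, the key polynomials `φ 1, …, φ n` and
`φ (n + 1) := f` satisfy `deg φ (i + 1) = r i * deg φ i`, where `r i` is the order of `lam i` modulo
`(1 / deg φ i) ℤ`. Every conjugate `α` of the root satisfies `ν_K (φ i (α)) ≥ lam i`, so the
products `φ 1 (α) ^ a₁ * ⋯ * φ n (α) ^ aₙ`, one in each degree below `deg f`, remain integral after
division by `π ^ ⌊a₁ * lam 1 + ⋯ + aₙ * lam n⌋`. Undivided, they are unitriangular over the powers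
of `α`, so the sum of these exponents bounds half the discriminant bonus from below. The numbers
`a₁ * lam 1 + ⋯ + aₙ * lam n` run once through the classes of `(1 / deg f) ℤ` modulo `ℤ`, so twice
the total `B n` of their integral parts is given by `B 0 = 0` and
`B i = r i * B (i - 1) + (r i - 1) * (r i * deg φ i * lam i - 1)`. Dropping `r n * B (n - 1) ≥ 0`
yields the bound, strictly if `r n > 2`; in the case of equality `B (n - 1) = 0`, which forces
`n = 2` and `r 1 * lam 1 = 1`. The last equation is the Eisenstein condition on the constant term of
`φ 2`.
-/

namespace MacLane

section Digits

variable {K : Type*} [Field K] {φ : K[X]}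

lemma add_divByMonic (hφ : φ.Monic) (f g : K[X]) : (f + g) /ₘ φ = f /ₘ φ + g /ₘ φ := by
  refine (div_modByMonic_unique _ (f %ₘ φ + g %ₘ φ) hφ ⟨?_, ?_⟩).1
  · linear_combination modByMonic_add_div f φ + modByMonic_add_div g φ
  · exact (degree_add_le _ _).trans_lt
      (max_lt (degree_modByMonic_lt _ hφ) (degree_modByMonic_lt _ hφ))

lemma C_mul_divByMonic (hφ : φ.Monic) (t : K) (f : K[X]) :
    (C t * f) /ₘ φ = C t * (f /ₘ φ) := by
  refine (div_modByMonic_unique _ (C t * (f %ₘ φ)) hφ ⟨?_, ?_⟩).1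
  · linear_combination C t * modByMonic_add_div f φ
  · rw [← smul_eq_C_mul]
    exact (degree_smul_le _ _).trans_lt (degree_modByMonic_lt _ hφ)

lemma divByMonic_divByMonic (hφ : φ.Monic) {ψ : K[X]} (hψ : ψ.Monic) (f : K[X]) :
    (f /ₘ ψ) /ₘ φ = f /ₘ (ψ * φ) := by
  refine ((div_modByMonic_unique _ (f %ₘ ψ + ψ * ((f /ₘ ψ) %ₘ φ)) (hψ.mul hφ) ⟨?_, ?_⟩).1).symm
  · linear_combination modByMonic_add_div f ψ + ψ * modByMonic_add_div (f /ₘ ψ) φ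
  · refine (degree_add_le _ _).trans_lt (max_lt ?_ ?_) <;> rw [degree_mul]
    · exact (degree_modByMonic_lt _ hψ).trans_le
        (le_add_of_nonneg_right (zero_le_degree_iff.2 hφ.ne_zero))
    · rw [degree_mul]
      exact WithBot.add_lt_add_left (degree_ne_bot.2 hψ.ne_zero) (degree_modByMonic_lt _ hφ)

lemma ne_one_of_natDegree_pos (hd : 0 < φ.natDegree) : φ ≠ 1 :=
  fun h => hd.ne' (h ▸ natDegree_one)

lemma natDegree_zero_lt (hd : 0 < φ.natDegree) : (0 : K[X]).natDegree < φ.natDegree := by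
  rwa [natDegree_zero]

lemma natDegree_one_lt (hd : 0 < φ.natDegree) : (1 : K[X]).natDegree < φ.natDegree := by
  rwa [natDegree_one]

lemma digit_zero_right (φ f : K[X]) : digit φ f 0 = f %ₘ φ := by
  rw [digit, pow_zero, divByMonic_one]

lemma digit_add (hφ : φ.Monic) (f g : K[X]) (i : ℕ) :
    digit φ (f + g) i = digit φ f i + digit φ g i := by
  rw [digit, add_divByMonic (hφ.pow i), add_modByMonic, digit, digit]

lemma digit_C_mul (hφ : φ.Monic) (t : K) (f : K[X]) (i : ℕ) :
    digit φ (C t * f) i = C t * digit φ f i := by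
  rw [digit, C_mul_divByMonic (hφ.pow i), ← smul_eq_C_mul, smul_modByMonic, digit, smul_eq_C_mul]

lemma digit_neg (hφ : φ.Monic) (f : K[X]) (i : ℕ) : digit φ (-f) i = -digit φ f i := by
  simpa only [C_neg, C_1, neg_one_mul] using digit_C_mul hφ (-1) f i

lemma digit_sub (hφ : φ.Monic) (f g : K[X]) (i : ℕ) :
    digit φ (f - g) i = digit φ f i - digit φ g i := by
  rw [sub_eq_add_neg, digit_add hφ, digit_neg hφ, ← sub_eq_add_neg]

lemma natDegree_digit_lt (hφ : φ.Monic) (hd : 0 < φ.natDegree) (f : K[X]) (i : ℕ) :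
    (digit φ f i).natDegree < φ.natDegree :=
  natDegree_modByMonic_lt _ hφ (ne_one_of_natDegree_pos hd)

lemma digit_add_right (hφ : φ.Monic) (f : K[X]) (i j : ℕ) :
    digit φ f (i + j) = digit φ (f /ₘ φ ^ j) i := by
  rw [digit, digit, divByMonic_divByMonic (hφ.pow i) (hφ.pow j), add_comm i j, pow_add]

lemma digit_eq_zero_of_natDegree_lt (hφ : φ.Monic) {f : K[X]} {i : ℕ}
    (hi : f.natDegree < i * φ.natDegree) : digit φ f i = 0 := by
  rw [digit, (divByMonic_eq_zero_iff (hφ.pow i)).2, zero_modByMonic]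
  exact degree_lt_degree (by rwa [natDegree_pow])

lemma digit_pow_mul_add (hφ : φ.Monic) (f : K[X]) (i j : ℕ) :
    digit φ (φ ^ j * f) (i + j) = digit φ f i := by
  rw [digit_add_right hφ, mul_divByMonic_cancel_left _ (hφ.pow j)]

lemma digit_pow_mul_of_lt (hφ : φ.Monic) (f : K[X]) {i j : ℕ} (hij : i < j) :
    digit φ (φ ^ j * f) i = 0 := by
  obtain ⟨k, rfl⟩ := Nat.exists_eq_add_of_lt hij
  have hsplit : φ ^ (i + k + 1) * f = φ ^ i * (φ * (φ ^ k * f)) := by ring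
  rw [hsplit, digit, mul_divByMonic_cancel_left _ (hφ.pow i), mul_comm, mul_self_modByMonic hφ]

lemma digit_of_natDegree_lt (hφ : φ.Monic) {a : K[X]} (ha : a.natDegree < φ.natDegree) (i : ℕ) :
    digit φ a i = if i = 0 then a else 0 := by
  split_ifs with hi
  · rw [hi, digit_zero_right, (modByMonic_eq_self_iff hφ).2 (degree_lt_degree ha)]
  · exact digit_eq_zero_of_natDegree_lt hφ
      (ha.trans_le (Nat.le_mul_of_pos_left _ (Nat.pos_of_ne_zero hi)))

lemma digit_pow_mul_of_natDegree_lt (hφ : φ.Monic) {a : K[X]}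
    (ha : a.natDegree < φ.natDegree) (i j : ℕ) :
    digit φ (φ ^ j * a) i = if i = j then a else 0 := by
  rcases lt_or_ge i j with hij | hij
  · rw [digit_pow_mul_of_lt hφ _ hij, if_neg hij.ne]
  · obtain ⟨k, rfl⟩ := Nat.exists_eq_add_of_le' hij
    rw [digit_pow_mul_add hφ, digit_of_natDegree_lt hφ ha]
    simp only [Nat.add_eq_right]

lemma digit_modByMonic_pow (hφ : φ.Monic) (f : K[X]) (i k : ℕ) :
    digit φ (f %ₘ φ ^ i) k = if k < i then digit φ f k else 0 := by
  have hsplit := digit_add hφ (f %ₘ φ ^ i) (φ ^ i * (f /ₘ φ ^ i)) k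
  rw [modByMonic_add_div] at hsplit
  split_ifs with hki
  · rw [hsplit, digit_pow_mul_of_lt hφ _ hki, add_zero]
  · obtain ⟨l, rfl⟩ := Nat.exists_eq_add_of_le' (not_lt.1 hki)
    rw [digit_pow_mul_add hφ, digit_add_right hφ] at hsplit
    exact right_eq_add.1 hsplit

lemma sum_digit_add (hφ : φ.Monic) (f : K[X]) (n : ℕ) :
    ∑ i ∈ Finset.range n, φ ^ i * digit φ f i + φ ^ n * (f /ₘ φ ^ n) = f := by
  induction n with
  | zero => simp
  | succ n ih =>
    have hdiv := modByMonic_add_div (f /ₘ φ ^ n) φ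
    rw [divByMonic_divByMonic hφ (hφ.pow n), ← pow_succ] at hdiv
    rw [Finset.sum_range_succ, digit]
    linear_combination ih + φ ^ n * hdiv

lemma sum_digit (hφ : φ.Monic) {f : K[X]} {n : ℕ} (hn : f.natDegree < n * φ.natDegree) :
    ∑ i ∈ Finset.range n, φ ^ i * digit φ f i = f := by
  have hdiv : f /ₘ φ ^ n = 0 :=
    (divByMonic_eq_zero_iff (hφ.pow n)).2 (degree_lt_degree (by rwa [natDegree_pow]))
  simpa only [hdiv, mul_zero, add_zero] using sum_digit_add hφ f n

lemma natDegree_lt_succ_mul (hd : 0 < φ.natDegree) (f : K[X]) :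
    f.natDegree < (f.natDegree + 1) * φ.natDegree :=
  (Nat.lt_succ_self _).trans_le (Nat.le_mul_of_pos_right _ hd)

lemma digit_of_natDegree_eq (hφ : φ.Monic) (hd : 0 < φ.natDegree) {f : K[X]} (hf : f.Monic)
    {r : ℕ} (hr : f.natDegree = r * φ.natDegree) : digit φ f r = 1 := by
  have hdeg : f.degree = (φ ^ r).degree := by
    rw [degree_eq_natDegree hf.ne_zero, degree_eq_natDegree (hφ.pow r).ne_zero, natDegree_pow, hr]
  have hlt : (f - φ ^ r).degree < (φ ^ r).degree :=
    hdeg ▸ degree_sub_lt_left hdeg hf.ne_zero (hf.leadingCoeff.trans (hφ.pow r).leadingCoeff.symm)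
  have hzero : digit φ (f - φ ^ r) r = 0 := by
    rw [digit, (divByMonic_eq_zero_iff (hφ.pow r)).2 hlt, zero_modByMonic]
  rw [digit_sub hφ, sub_eq_zero] at hzero
  rw [hzero, ← mul_one (φ ^ r), digit_pow_mul_of_natDegree_lt hφ (natDegree_one_lt hd), if_pos rfl]

lemma digit_X (f : K[X]) (i : ℕ) : digit X f i = C (f.coeff i) := by
  induction f using Polynomial.induction_on' with
  | add p q hp hq => rw [digit_add monic_X, hp, hq, coeff_add, C_add]
  | monomial n a =>
    have ha : (C a).natDegree < (X : K[X]).natDegree := by simp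
    rw [← C_mul_X_pow_eq_monomial, mul_comm, digit_pow_mul_of_natDegree_lt monic_X ha, mul_comm,
      coeff_C_mul_X_pow, apply_ite C, C_0]

end Digits

section Augment

variable {K : Type*} [Field K]

/-- The value `v(aᵢ) + i * lam` of the term `aᵢ φ ^ i` of the `φ`-adic expansion of `f`, for the
valuation `v` augmented by `φ ↦ lam`. -/
noncomputable def termVal (v : K[X] → WithTop ℚ) (φ : K[X]) (lam : ℚ) (f : K[X]) (i : ℕ) :
    WithTop ℚ :=
  v (digit φ f i) + ((i * lam : ℚ) : WithTop ℚ)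

/-- The indices of the terms of the `φ`-adic expansion of `f` that have minimal value; these terms
make up the initial form of `f` for the augmented valuation. -/
def IsInitial (v : K[X] → WithTop ℚ) (φ : K[X]) (lam : ℚ) (f : K[X]) (i : ℕ) : Prop :=
  augment v φ lam f = termVal v φ lam f i

lemma exists_isInitial (v : K[X] → WithTop ℚ) (φ : K[X]) (lam : ℚ) (f : K[X]) :
    ∃ i, IsInitial v φ lam f i :=
  let ⟨i, _, hi⟩ := Finset.exists_mem_eq_inf (Finset.range (f.natDegree + 1)) (by simp)
    (termVal v φ lam f)
  ⟨i, hi⟩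

/-- The conditions on a valuation `v` under which `augment v φ lam` is again a valuation. They
only involve polynomials of degree less than that of `φ`. -/
structure Augmentable (v : AddValuation K[X] (WithTop ℚ)) (φ : K[X]) (lam : ℚ) : Prop where
  monic : φ.Monic
  natDegree_pos : 0 < φ.natDegree
  ne_top : ∀ a : K[X], a ≠ 0 → a.natDegree < φ.natDegree → v a ≠ ⊤
  map_mod : ∀ a b : K[X], a.natDegree < φ.natDegree → b.natDegree < φ.natDegree →
    v ((a * b) %ₘ φ) = v a + v b
  lt_map_div : ∀ a b : K[X], a ≠ 0 → b ≠ 0 → a.natDegree < φ.natDegree →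
    b.natDegree < φ.natDegree → v a + v b < v ((a * b) /ₘ φ) + lam

variable {v : AddValuation K[X] (WithTop ℚ)} {φ : K[X]} {lam : ℚ}

lemma termVal_of_digit_eq_zero {f : K[X]} {i : ℕ} (hi : digit φ f i = 0) :
    termVal v φ lam f i = ⊤ := by
  rw [termVal, hi, v.map_zero, top_add]

lemma termVal_pow_mul_add (hφ : φ.Monic) (f : K[X]) (i j : ℕ) :
    termVal v φ lam (φ ^ j * f) (i + j) = termVal v φ lam f i + ((j * lam : ℚ) : WithTop ℚ) := by
  rw [termVal, digit_pow_mul_add hφ, Nat.cast_add, add_mul, WithTop.coe_add, ← add_assoc, termVal]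

lemma le_augment_iff (hφ : φ.Monic) (hd : 0 < φ.natDegree) {f : K[X]} {g : WithTop ℚ} :
    g ≤ augment v φ lam f ↔ ∀ i, g ≤ termVal v φ lam f i := by
  refine Finset.le_inf_iff.trans ⟨fun H i => ?_, fun H i _ => H i⟩
  rcases lt_or_ge i (f.natDegree + 1) with hi | hi
  · exact H i (Finset.mem_range.2 hi)
  · have hdeg : f.natDegree < i * φ.natDegree := hi.trans (Nat.le_mul_of_pos_right _ hd)
    exact (termVal_of_digit_eq_zero (digit_eq_zero_of_natDegree_lt hφ hdeg)) ▸ le_top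

lemma augment_le (hφ : φ.Monic) (hd : 0 < φ.natDegree) (f : K[X]) (i : ℕ) :
    augment v φ lam f ≤ termVal v φ lam f i :=
  (le_augment_iff hφ hd).1 le_rfl i

lemma augment_lt_termVal (hφ : φ.Monic) (hd : 0 < φ.natDegree) {f : K[X]} {i : ℕ}
    (hi : ¬ IsInitial v φ lam f i) : augment v φ lam f < termVal v φ lam f i :=
  lt_of_le_of_ne (augment_le hφ hd f i) hi

lemma augment_of_natDegree_lt (hφ : φ.Monic) (hd : 0 < φ.natDegree) {a : K[X]}
    (ha : a.natDegree < φ.natDegree) : augment v φ lam a = v a := by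
  have hterm : ∀ i, termVal v φ lam a i = if i = 0 then v a else ⊤ := by
    intro i
    split_ifs with hi <;> simp [termVal, digit_of_natDegree_lt hφ ha, hi]
  refine le_antisymm ((augment_le hφ hd a 0).trans_eq (hterm 0)) ?_
  refine (le_augment_iff hφ hd).2 fun i => ?_
  rw [hterm]
  split_ifs
  exacts [le_rfl, le_top]

lemma augment_zero (hφ : φ.Monic) (hd : 0 < φ.natDegree) : augment v φ lam 0 = ⊤ := by
  rw [augment_of_natDegree_lt hφ hd (natDegree_zero_lt hd), v.map_zero]

lemma augment_one (hφ : φ.Monic) (hd : 0 < φ.natDegree) : augment v φ lam 1 = 0 := by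
  rw [augment_of_natDegree_lt hφ hd (natDegree_one_lt hd), v.map_one]

lemma augment_pow_mul (hφ : φ.Monic) (hd : 0 < φ.natDegree) (f : K[X]) (j : ℕ) :
    augment v φ lam (φ ^ j * f) = augment v φ lam f + ((j * lam : ℚ) : WithTop ℚ) := by
  apply le_antisymm
  · obtain ⟨i, hi⟩ := exists_isInitial v φ lam f
    rw [hi, ← termVal_pow_mul_add hφ]
    exact augment_le hφ hd _ _
  · refine (le_augment_iff hφ hd).2 fun i => ?_
    rcases lt_or_ge i j with hij | hij
    · exact (termVal_of_digit_eq_zero (digit_pow_mul_of_lt hφ _ hij)) ▸ le_top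
    · obtain ⟨k, rfl⟩ := Nat.exists_eq_add_of_le' hij
      rw [termVal_pow_mul_add hφ]
      gcongr
      exact augment_le hφ hd f k

lemma augment_neg (hφ : φ.Monic) (f : K[X]) : augment v φ lam (-f) = augment v φ lam f := by
  simp only [augment, natDegree_neg, digit_neg hφ, v.map_neg]

lemma min_le_augment_add (hφ : φ.Monic) (hd : 0 < φ.natDegree) (f g : K[X]) :
    min (augment v φ lam f) (augment v φ lam g) ≤ augment v φ lam (f + g) := by
  refine (le_augment_iff hφ hd).2 fun i => ?_
  calc min (augment v φ lam f) (augment v φ lam g)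
      ≤ min (termVal v φ lam f i) (termVal v φ lam g i) :=
        min_le_min (augment_le hφ hd f i) (augment_le hφ hd g i)
    _ = min (v (digit φ f i)) (v (digit φ g i)) + ((i * lam : ℚ) : WithTop ℚ) :=
        min_add_add_right _ _ _
    _ ≤ termVal v φ lam (f + g) i := by
        rw [termVal, digit_add hφ]
        gcongr
        exact v.map_add _ _

lemma lt_augment_add (hφ : φ.Monic) (hd : 0 < φ.natDegree) {f g : K[X]} {x : WithTop ℚ}
    (hf : x < augment v φ lam f) (hg : x < augment v φ lam g) : x < augment v φ lam (f + g) :=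
  (lt_min hf hg).trans_le (min_le_augment_add hφ hd f g)

lemma min_le_augment_sub (hφ : φ.Monic) (hd : 0 < φ.natDegree) (f g : K[X]) :
    min (augment v φ lam f) (augment v φ lam g) ≤ augment v φ lam (f - g) := by
  rw [sub_eq_add_neg, ← augment_neg hφ g]
  exact min_le_augment_add hφ hd f (-g)

lemma le_augment_sum (hφ : φ.Monic) (hd : 0 < φ.natDegree) {ι : Type*} (s : Finset ι)
    (F : ι → K[X]) {g : WithTop ℚ} (hg : ∀ i ∈ s, g ≤ augment v φ lam (F i)) :
    g ≤ augment v φ lam (∑ i ∈ s, F i) :=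
  Finset.sum_induction F (fun p => g ≤ augment v φ lam p)
    (fun p q hp hq => (le_min hp hq).trans (min_le_augment_add hφ hd p q))
    (by rw [augment_zero hφ hd]; exact le_top) hg

namespace Augmentable

lemma digit_lt (H : Augmentable v φ lam) (f : K[X]) (i : ℕ) :
    (digit φ f i).natDegree < φ.natDegree :=
  natDegree_digit_lt H.monic H.natDegree_pos f i

lemma map_eq_top_iff (H : Augmentable v φ lam) {a : K[X]} (ha : a.natDegree < φ.natDegree) :
    v a = ⊤ ↔ a = 0 :=
  ⟨fun h => by_contra fun h0 => H.ne_top a h0 ha h, fun h => h ▸ v.map_zero⟩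

lemma natDegree_mul_div_lt (H : Augmentable v φ lam) {a b : K[X]}
    (ha : a.natDegree < φ.natDegree) (hb : b.natDegree < φ.natDegree) :
    ((a * b) /ₘ φ).natDegree < φ.natDegree := by
  have hmul := natDegree_mul_le (p := a) (q := b)
  rw [natDegree_divByMonic _ H.monic]
  omega

lemma add_le_augment_mul_of_natDegree_lt (H : Augmentable v φ lam) {a b : K[X]}
    (ha : a.natDegree < φ.natDegree) (hb : b.natDegree < φ.natDegree) :
    v a + v b ≤ augment v φ lam (a * b) := by
  rcases eq_or_ne a 0 with rfl | ha0
  · rw [zero_mul, augment_zero H.monic H.natDegree_pos]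
    exact le_top
  rcases eq_or_ne b 0 with rfl | hb0
  · rw [mul_zero, augment_zero H.monic H.natDegree_pos]
    exact le_top
  have hmod : augment v φ lam ((a * b) %ₘ φ) = v a + v b := by
    rw [augment_of_natDegree_lt H.monic H.natDegree_pos, H.map_mod a b ha hb]
    exact natDegree_modByMonic_lt _ H.monic (ne_one_of_natDegree_pos H.natDegree_pos)
  have hdiv : v a + v b < augment v φ lam (φ * ((a * b) /ₘ φ)) := by
    have hpow := augment_pow_mul (v := v) (lam := lam) H.monic H.natDegree_pos ((a * b) /ₘ φ) 1
    rw [pow_one, Nat.cast_one, one_mul,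
      augment_of_natDegree_lt H.monic H.natDegree_pos (H.natDegree_mul_div_lt ha hb)] at hpow
    exact hpow ▸ H.lt_map_div a b ha0 hb0 ha hb
  rw [← modByMonic_add_div (a * b) φ]
  exact (le_min hmod.ge hdiv.le).trans (min_le_augment_add H.monic H.natDegree_pos _ _)

lemma augment_add_le_augment_mul (H : Augmentable v φ lam) (f g : K[X]) :
    augment v φ lam f + augment v φ lam g ≤ augment v φ lam (f * g) := by
  conv_rhs => rw [← sum_digit H.monic (natDegree_lt_succ_mul H.natDegree_pos f),
    ← sum_digit H.monic (natDegree_lt_succ_mul H.natDegree_pos g), Finset.sum_mul_sum]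
  refine le_augment_sum H.monic H.natDegree_pos _ _ fun i _ => ?_
  refine le_augment_sum H.monic H.natDegree_pos _ _ fun j _ => ?_
  have hterm : φ ^ i * digit φ f i * (φ ^ j * digit φ g j) =
    φ ^ (i + j) * (digit φ f i * digit φ g j) := by ring
  rw [hterm, augment_pow_mul H.monic H.natDegree_pos]
  calc augment v φ lam f + augment v φ lam g
      ≤ termVal v φ lam f i + termVal v φ lam g j :=
        add_le_add (augment_le H.monic H.natDegree_pos f i) (augment_le H.monic H.natDegree_pos g j)
    _ = v (digit φ f i) + v (digit φ g j) + (((i + j : ℕ) * lam : ℚ) : WithTop ℚ) := by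
        rw [termVal, termVal, add_add_add_comm, ← WithTop.coe_add, ← add_mul, Nat.cast_add]
    _ ≤ augment v φ lam (digit φ f i * digit φ g j) + (((i + j : ℕ) * lam : ℚ) : WithTop ℚ) := by
        gcongr
        exact H.add_le_augment_mul_of_natDegree_lt (H.digit_lt f i) (H.digit_lt g j)

lemma augment_ne_top (H : Augmentable v φ lam) {f : K[X]} (hf : f ≠ 0) :
    augment v φ lam f ≠ ⊤ := by
  contrapose! hf
  rw [← sum_digit H.monic (natDegree_lt_succ_mul H.natDegree_pos f)]
  refine Finset.sum_eq_zero fun i _ => ?_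
  have hle := augment_le (v := v) (lam := lam) H.monic H.natDegree_pos f i
  rw [hf, top_le_iff, termVal, WithTop.add_eq_top, or_iff_left WithTop.coe_ne_top] at hle
  rw [(H.map_eq_top_iff (H.digit_lt f i)).1 hle, mul_zero]

lemma exists_first_isInitial (H : Augmentable v φ lam) {f : K[X]} (hf : f ≠ 0) :
    ∃ i, IsInitial v φ lam f i ∧ augment v φ lam f < augment v φ lam (f %ₘ φ ^ i) := by
  classical
  have hex := exists_isInitial v φ lam f
  refine ⟨Nat.find hex, Nat.find_spec hex, ?_⟩
  obtain ⟨k, hk⟩ := exists_isInitial v φ lam (f %ₘ φ ^ Nat.find hex)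
  rw [hk, termVal, digit_modByMonic_pow H.monic]
  split_ifs with hki
  · exact augment_lt_termVal H.monic H.natDegree_pos (Nat.find_min hex hki)
  · rw [v.map_zero, top_add]
    exact lt_top_iff_ne_top.2 (H.augment_ne_top hf)

lemma augment_pow_mul_mul_le (H : Augmentable v φ lam) (f g : K[X]) (i j : ℕ) :
    augment v φ lam (φ ^ i * (f /ₘ φ ^ i) * (φ ^ j * (g /ₘ φ ^ j))) ≤
      termVal v φ lam f i + termVal v φ lam g j := by
  have hpow : φ ^ i * (f /ₘ φ ^ i) * (φ ^ j * (g /ₘ φ ^ j)) =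
    φ ^ (i + j) * ((f /ₘ φ ^ i) * (g /ₘ φ ^ j)) := by ring
  have hdigit : digit φ ((f /ₘ φ ^ i) * (g /ₘ φ ^ j)) 0 =
      (digit φ f i * digit φ g j) %ₘ φ := by
    rw [digit_zero_right, mul_modByMonic, digit, digit]
  have hle := augment_le (v := v) (lam := lam) H.monic H.natDegree_pos
    ((f /ₘ φ ^ i) * (g /ₘ φ ^ j)) 0
  rw [termVal, hdigit, H.map_mod _ _ (H.digit_lt f i) (H.digit_lt g j), Nat.cast_zero, zero_mul,
    WithTop.coe_zero, add_zero] at hle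
  rw [hpow, augment_pow_mul H.monic H.natDegree_pos, termVal, termVal, add_add_add_comm,
    ← WithTop.coe_add, ← add_mul, ← Nat.cast_add]
  gcongr

lemma augment_mul (H : Augmentable v φ lam) (f g : K[X]) :
    augment v φ lam (f * g) = augment v φ lam f + augment v φ lam g := by
  rcases eq_or_ne f 0 with rfl | hf
  · rw [zero_mul, augment_zero H.monic H.natDegree_pos, top_add]
  rcases eq_or_ne g 0 with rfl | hg
  · rw [mul_zero, augment_zero H.monic H.natDegree_pos, add_top]
  refine le_antisymm ?_ (H.augment_add_le_augment_mul f g)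
  obtain ⟨i, hi, hr⟩ := H.exists_first_isInitial hf
  obtain ⟨j, hj, hs⟩ := H.exists_first_isInitial hg
  set r := f %ₘ φ ^ i
  set s := g %ₘ φ ^ j
  have hF : φ ^ i * (f /ₘ φ ^ i) = f - r := eq_sub_of_add_eq' (modByMonic_add_div f _)
  have hG : φ ^ j * (g /ₘ φ ^ j) = g - s := eq_sub_of_add_eq' (modByMonic_add_div g _)
  have hle := H.augment_pow_mul_mul_le f g i j
  rw [← hi, ← hj, hF, hG, show (f - r) * (g - s) = f * g - (r * g + (f - r) * s) by ring] at hle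
  have hfr : augment v φ lam f ≤ augment v φ lam (f - r) :=
    (le_min le_rfl hr.le).trans (min_le_augment_sub H.monic H.natDegree_pos f r)
  have hrest : augment v φ lam f + augment v φ lam g <
      augment v φ lam (r * g + (f - r) * s) := by
    apply lt_augment_add H.monic H.natDegree_pos
    · exact (WithTop.add_lt_add_of_lt_of_le (H.augment_ne_top hg) hr le_rfl).trans_le
        (H.augment_add_le_augment_mul _ _)
    · exact (WithTop.add_lt_add_of_le_of_lt (H.augment_ne_top hf) hfr hs).trans_le
        (H.augment_add_le_augment_mul _ _)
  by_contra! hlt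
  exact hle.not_gt ((lt_min hlt hrest).trans_le (min_le_augment_sub H.monic H.natDegree_pos _ _))

/-- The augmented valuation, as a bundled valuation. -/
noncomputable def valuation (H : Augmentable v φ lam) : AddValuation K[X] (WithTop ℚ) :=
  AddValuation.of (augment v φ lam) (augment_zero H.monic H.natDegree_pos)
    (augment_one H.monic H.natDegree_pos) (min_le_augment_add H.monic H.natDegree_pos)
    H.augment_mul

lemma coe_valuation (H : Augmentable v φ lam) : ⇑H.valuation = augment v φ lam := rfl

lemma valuation_of_natDegree_lt (H : Augmentable v φ lam) {a : K[X]}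
    (ha : a.natDegree < φ.natDegree) : H.valuation a = v a :=
  augment_of_natDegree_lt H.monic H.natDegree_pos ha

lemma valuation_pow_mul (H : Augmentable v φ lam) (f : K[X]) (j : ℕ) :
    H.valuation (φ ^ j * f) = H.valuation f + ((j * lam : ℚ) : WithTop ℚ) :=
  augment_pow_mul H.monic H.natDegree_pos f j

lemma valuation_ne_top (H : Augmentable v φ lam) {f : K[X]} (hf : f ≠ 0) : H.valuation f ≠ ⊤ :=
  H.augment_ne_top hf

end Augmentable

end Augment

section Ord

variable (O : Type*) [CommRing O] [IsDomain O] [IsDiscreteValuationRing O]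
variable {K : Type*} [Field K] [Algebra O K] [IsFractionRing O K]

lemma ord_zero : ord O (0 : K) = ⊤ := if_pos rfl

lemma ord_of_ne_zero {x : K} (hx : x ≠ 0) : ord O x = ((ordInt O x : ℚ) : WithTop ℚ) :=
  if_neg hx

lemma adicValuation_ne_zero {x : K} (hx : x ≠ 0) :
    (IsDiscreteValuationRing.maximalIdeal O).valuation K x ≠ 0 :=
  (Valuation.ne_zero_iff _).2 hx

lemma ordInt_mul {x y : K} (hx : x ≠ 0) (hy : y ≠ 0) :
    ordInt O (x * y) = ordInt O x + ordInt O y := by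
  rw [ordInt, map_mul, WithZero.log_mul (adicValuation_ne_zero O hx) (adicValuation_ne_zero O hy),
    neg_add, ordInt, ordInt]

lemma ordInt_one : ordInt O (1 : K) = 0 := by
  rw [ordInt, map_one, WithZero.log_one, neg_zero]

lemma ordInt_zpow (x : K) (k : ℤ) : ordInt O (x ^ k) = k * ordInt O x := by
  rw [ordInt, map_zpow₀, WithZero.log_zpow, ordInt, smul_eq_mul, mul_neg]

lemma ordInt_pow (x : K) (k : ℕ) : ordInt O (x ^ k) = k * ordInt O x :=
  mod_cast ordInt_zpow O x k

lemma ordInt_prod {ι : Type*} (s : Finset ι) (F : ι → K) (hF : ∀ i ∈ s, F i ≠ 0) :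
    ordInt O (∏ i ∈ s, F i) = ∑ i ∈ s, ordInt O (F i) := by
  classical
  induction s using Finset.induction_on with
  | empty => rw [Finset.prod_empty, Finset.sum_empty, ordInt_one]
  | insert a s ha ih =>
    have hs : ∀ i ∈ s, F i ≠ 0 := fun i hi => hF i (Finset.mem_insert_of_mem hi)
    rw [Finset.prod_insert ha, Finset.sum_insert ha, ← ih hs,
      ordInt_mul O (hF a (Finset.mem_insert_self a s)) (Finset.prod_ne_zero_iff.2 hs)]

lemma ord_le_ord {x y : K} : ord O x ≤ ord O y ↔
    (IsDiscreteValuationRing.maximalIdeal O).valuation K y ≤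
      (IsDiscreteValuationRing.maximalIdeal O).valuation K x := by
  rcases eq_or_ne y 0 with rfl | hy
  · simp [ord_zero]
  rcases eq_or_ne x 0 with rfl | hx
  · simp [ord_zero, ord_of_ne_zero O hy, hy]
  rw [ord_of_ne_zero O hx, ord_of_ne_zero O hy, WithTop.coe_le_coe, Int.cast_le, ordInt, ordInt,
    neg_le_neg_iff, WithZero.log_le_log (adicValuation_ne_zero O hy) (adicValuation_ne_zero O hx)]

lemma min_le_ord_add (x y : K) : min (ord O x) (ord O y) ≤ ord O (x + y) := by
  rw [min_le_iff, ord_le_ord, ord_le_ord, ← le_max_iff]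
  exact Valuation.map_add _ x y

lemma ord_one : ord O (1 : K) = 0 := by
  rw [ord_of_ne_zero O one_ne_zero, ordInt_one, Int.cast_zero, WithTop.coe_zero]

lemma ord_mul (x y : K) : ord O (x * y) = ord O x + ord O y := by
  rcases eq_or_ne x 0 with rfl | hx
  · rw [zero_mul, ord_zero, top_add]
  rcases eq_or_ne y 0 with rfl | hy
  · rw [mul_zero, ord_zero, add_top]
  rw [ord_of_ne_zero O hx, ord_of_ne_zero O hy, ord_of_ne_zero O (mul_ne_zero hx hy),
    ordInt_mul O hx hy, ← WithTop.coe_add, Int.cast_add]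

/-- The normalized valuation of `K`, as a bundled valuation. -/
noncomputable def ordVal : AddValuation K (WithTop ℚ) :=
  AddValuation.of (ord O) (ord_zero O) (ord_one O) (min_le_ord_add O) (ord_mul O)

lemma ordVal_apply (x : K) : ordVal O x = ord O x := rfl

lemma ord_nonneg_iff {x : K} : 0 ≤ ord O x ↔ ∃ a : O, algebraMap O K a = x := by
  rw [← ord_one O (K := K), ord_le_ord, map_one]
  refine ⟨fun h => IsDiscreteValuationRing.exists_lift_of_le_one h, ?_⟩
  rintro ⟨a, rfl⟩
  exact IsDedekindDomain.HeightOneSpectrum.valuation_le_one _ a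

lemma ord_algebraMap_nonneg (a : O) : 0 ≤ ord O (algebraMap O K a) :=
  (ord_nonneg_iff O).2 ⟨a, rfl⟩

lemma ord_algebraMap_pos_iff {a : O} :
    0 < ord O (algebraMap O K a) ↔ a ∈ IsLocalRing.maximalIdeal O := by
  rw [← ord_one O (K := K), ← not_le, ord_le_ord, map_one, not_le]
  exact IsDedekindDomain.HeightOneSpectrum.valuation_lt_one_iff_mem _ a

lemma exists_ordInt_eq_one (K : Type*) [Field K] [Algebra O K] [IsFractionRing O K] :
    ∃ p : K, p ≠ 0 ∧ ordInt O p = 1 := by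
  obtain ⟨p, hp⟩ := (IsDiscreteValuationRing.maximalIdeal O).valuation_exists_uniformizer K
  refine ⟨p, ?_, ?_⟩
  · rintro rfl
    rw [map_zero] at hp
    exact WithZero.exp_ne_zero hp.symm
  · rw [ordInt, hp, WithZero.log_exp, neg_neg]

lemma exists_ordInt_eq (K : Type*) [Field K] [Algebra O K] [IsFractionRing O K] (k : ℤ) :
    ∃ p : K, p ≠ 0 ∧ ordInt O p = k := by
  obtain ⟨p, hp, hone⟩ := exists_ordInt_eq_one O K
  exact ⟨p ^ k, zpow_ne_zero k hp, by rw [ordInt_zpow, hone, mul_one]⟩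

end Ord

section Gauss

variable (O : Type*) [CommRing O] [IsDomain O] [IsDiscreteValuationRing O]
variable {K : Type*} [Field K] [Algebra O K] [IsFractionRing O K]

/-- The valuation of the value of a polynomial at `0`. The Gauss valuation is its augmentation by
`X ↦ 0`, which makes it the first step of every inductive valuation. -/
noncomputable def evalVal : AddValuation K[X] (WithTop ℚ) :=
  (ordVal O).comap (evalRingHom (0 : K))

lemma evalVal_apply (f : K[X]) : evalVal O f = ord O (f.eval 0) := rfl

lemma evalVal_C (a : K) : evalVal O (C a) = ord O a := by
  rw [evalVal_apply, eval_C]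

lemma termVal_evalVal_X (f : K[X]) (i : ℕ) :
    termVal (evalVal O) X 0 f i = ord O (f.coeff i) := by
  rw [termVal, digit_X, evalVal_C, mul_zero, WithTop.coe_zero, add_zero]

lemma gauss_eq_augment : (gauss O : K[X] → WithTop ℚ) = augment (evalVal O) X 0 := by
  funext f
  apply le_antisymm
  · refine (le_augment_iff monic_X (by simp)).2 fun i => ?_
    rw [termVal_evalVal_X]
    by_cases hi : f.coeff i = 0
    · exact hi ▸ (ord_zero O (K := K)).symm ▸ le_top
    · exact Finset.inf_le (mem_support_iff.2 hi)
  · refine Finset.le_inf_iff.2 fun i _ => ?_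
    rw [← termVal_evalVal_X]
    exact augment_le monic_X (by simp) f i

lemma augmentable_X : Augmentable (evalVal O) (X : K[X]) 0 := by
  have hconst : ∀ a : K[X], a.natDegree < (X : K[X]).natDegree → ∃ t : K, a = C t := fun a ha =>
    ⟨_, eq_C_of_natDegree_eq_zero (Nat.lt_one_iff.1 (by rwa [natDegree_X] at ha))⟩
  have hdeg : ∀ t : K, (C t).degree < (X : K[X]).degree := fun t =>
    degree_lt_degree (by simp)
  refine ⟨monic_X, by simp, fun a ha0 ha => ?_, fun a b ha hb => ?_, fun a b ha0 hb0 ha hb => ?_⟩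
  · obtain ⟨t, rfl⟩ := hconst a ha
    rw [evalVal_C, ← ordVal_apply, AddValuation.ne_top_iff]
    exact C_ne_zero.1 ha0
  · obtain ⟨s, rfl⟩ := hconst a ha
    obtain ⟨t, rfl⟩ := hconst b hb
    rw [← C_mul, (modByMonic_eq_self_iff monic_X).2 (hdeg _), C_mul, AddValuation.map_mul]
  · obtain ⟨s, rfl⟩ := hconst a ha
    obtain ⟨t, rfl⟩ := hconst b hb
    rw [← C_mul, (divByMonic_eq_zero_iff monic_X).2 (hdeg _), AddValuation.map_zero, top_add,
      ← AddValuation.map_mul, ← C_mul, evalVal_C, lt_top_iff_ne_top, ← ordVal_apply,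
      AddValuation.ne_top_iff]
    exact mul_ne_zero (C_ne_zero.1 ha0) (C_ne_zero.1 hb0)

end Gauss

section Key

variable {K : Type*} [Field K] {v : AddValuation K[X] (WithTop ℚ)}

lemma VEquiv.of_lt {f g : K[X]} (h : v f < v (f - g)) : VEquiv v f g :=
  ⟨(v.map_eq_of_lt_sub (by rwa [v.map_sub_swap])).symm, h⟩

lemma VEquiv.trans {f g h : K[X]} (h₁ : VEquiv v f g) (h₂ : VEquiv v g h) : VEquiv v f h := by
  refine VEquiv.of_lt ?_
  rw [← sub_add_sub_cancel f g h]
  exact v.map_lt_add h₁.2 (h₁.1 ▸ h₂.2)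

lemma VEquiv.symm {f g : K[X]} (h : VEquiv v f g) : VEquiv v g f :=
  ⟨h.1.symm, by rw [v.map_sub_swap, ← h.1]; exact h.2⟩

lemma VEquiv.ne_top {f g : K[X]} (h : VEquiv v f g) : v f ≠ ⊤ := h.2.ne_top

lemma VEquiv.refl {f : K[X]} (h : v f ≠ ⊤) : VEquiv v f f :=
  VEquiv.of_lt (by rw [sub_self, v.map_zero]; exact lt_top_iff_ne_top.2 h)

lemma VEquiv.mul_left {f g : K[X]} (h : VEquiv v f g) {p : K[X]} (hp : v p ≠ ⊤) :
    VEquiv v (p * f) (p * g) := by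
  refine VEquiv.of_lt ?_
  rw [← mul_sub, v.map_mul, v.map_mul]
  exact WithTop.add_lt_add_left hp h.2

lemma VDvd.of_vEquiv {φ f g : K[X]} (h : VDvd v φ f) (hfg : VEquiv v f g) : VDvd v φ g :=
  let ⟨p, hp⟩ := h
  ⟨p, hfg.symm.trans hp⟩

lemma VDvd.mul_left {φ f : K[X]} (h : VDvd v φ f) {p : K[X]} (hp : v p ≠ ⊤) :
    VDvd v φ (p * f) :=
  let ⟨q, hq⟩ := h
  ⟨p * q, by rw [mul_left_comm]; exact hq.mul_left hp⟩

lemma VDvd.refl {φ : K[X]} (h : v φ ≠ ⊤) : VDvd v φ φ :=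
  ⟨1, by rw [mul_one]; exact .refl h⟩

namespace IsKeyPoly

variable {O : Type*} [CommRing O] [Algebra O K] {φ : K[X]}

lemma not_vDvd_of_natDegree_lt (hk : IsKeyPoly O v φ) {f : K[X]}
    (hf : f.natDegree < φ.natDegree) : ¬ VDvd v φ f :=
  fun h => (hk.minimal f h).not_gt hf

lemma map_le_map_mul_div (hk : IsKeyPoly O v φ) (f : K[X]) : v f ≤ v (φ * (f /ₘ φ)) := by
  by_contra! hlt
  have hmod : f %ₘ φ = f - φ * (f /ₘ φ) := eq_sub_of_add_eq (modByMonic_add_div f φ)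
  have hdvd : VDvd v φ (f %ₘ φ) := by
    refine ⟨-(f /ₘ φ), VEquiv.of_lt ?_⟩
    rw [hmod, mul_neg, sub_neg_eq_add, sub_add_cancel, v.map_sub_eq_of_lt_right hlt]
    exact hlt
  exact hk.not_vDvd_of_natDegree_lt
    (natDegree_modByMonic_lt _ hk.monic (ne_one_of_natDegree_pos hk.natDegree_pos)) hdvd

lemma map_mod_of_not_vDvd (hk : IsKeyPoly O v φ) {f : K[X]} (hf : ¬ VDvd v φ f) :
    v (f %ₘ φ) = v f := by
  have hmod : f %ₘ φ = f - φ * (f /ₘ φ) := eq_sub_of_add_eq (modByMonic_add_div f φ)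
  apply le_antisymm
  · by_contra! hlt
    exact hf ⟨f /ₘ φ, VEquiv.of_lt (hmod ▸ hlt)⟩
  · rw [hmod]
    exact v.map_le_sub le_rfl (hk.map_le_map_mul_div f)

lemma augmentable (hk : IsKeyPoly O v φ) (htop : ∀ f : K[X], f ≠ 0 → v f ≠ ⊤) {lam : ℚ}
    (hlam : v φ < lam) : Augmentable v φ lam := by
  refine ⟨hk.monic, hk.natDegree_pos, fun a ha _ => htop a ha, fun a b ha hb => ?_,
    fun a b ha0 hb0 _ _ => ?_⟩
  · rw [hk.map_mod_of_not_vDvd, v.map_mul]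
    exact fun h => (hk.irreducible a b h).elim (hk.not_vDvd_of_natDegree_lt ha)
      (hk.not_vDvd_of_natDegree_lt hb)
  · rw [← v.map_mul]
    rcases eq_or_ne ((a * b) /ₘ φ) 0 with hq | hq
    · rw [hq, v.map_zero, top_add]
      exact lt_top_iff_ne_top.2 (htop _ (mul_ne_zero ha0 hb0))
    · refine (hk.map_le_map_mul_div _).trans_lt ?_
      rw [v.map_mul, add_comm]
      exact WithTop.add_lt_add_left (htop _ hq) hlam

lemma exists_vDvd_of_prod (hk : IsKeyPoly O v φ) (s : Multiset K[X])
    (h : VDvd v φ s.prod) : ∃ f ∈ s, VDvd v φ f := by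
  induction s using Multiset.induction_on with
  | empty =>
    rw [Multiset.prod_zero] at h
    exact absurd h (hk.not_vDvd_of_natDegree_lt (natDegree_one_lt hk.natDegree_pos))
  | cons a s ih =>
    rw [Multiset.prod_cons] at h
    rcases hk.irreducible _ _ h with ha | hs
    · exact ⟨a, Multiset.mem_cons_self a s, ha⟩
    · obtain ⟨f, hf, hd⟩ := ih hs
      exact ⟨f, Multiset.mem_cons_of_mem hf, hd⟩

lemma vDvd_of_pow (hk : IsKeyPoly O v φ) {f : K[X]} {n : ℕ} (h : VDvd v φ (f ^ n)) :
    VDvd v φ f := by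
  obtain ⟨g, hg, hd⟩ := hk.exists_vDvd_of_prod (Multiset.replicate n f)
    (by rwa [Multiset.prod_replicate])
  exact Multiset.eq_of_mem_replicate hg ▸ hd

end IsKeyPoly

end Key

section Arithmetic

lemma den_dvd_of_mul_eq_intCast {q : ℚ} {k l : ℤ} (h : k * q = l) : (q.den : ℤ) ∣ k := by
  have hnum : k * q.num = l * q.den := by
    have hq : (k : ℚ) * q.num = l * q.den := by rw [← Rat.mul_den_eq_num, ← mul_assoc, h]
    exact_mod_cast hq
  have hcop : IsCoprime (q.den : ℤ) q.num :=
    Int.isCoprime_iff_gcd_eq_one.2 ((Int.gcd_comm _ _).trans q.reduced)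
  exact hcop.dvd_of_dvd_mul_right (hnum ▸ dvd_mul_left _ _)

lemma exists_lt_den_mul_num_add (q : ℚ) (k : ℤ) :
    ∃ (j : ℕ) (l : ℤ), j < q.den ∧ j * q.num + l * q.den = k := by
  obtain ⟨a, b, hab⟩ : IsCoprime q.num (q.den : ℤ) := Int.isCoprime_iff_gcd_eq_one.2 q.reduced
  obtain ⟨j, hj, hmod⟩ := Int.existsUnique_equiv_nat (k * a) (Int.natCast_pos.2 q.den_pos)
  obtain ⟨c, hc⟩ := hmod.dvd
  exact ⟨j, k * b + c * q.num, by exact_mod_cast hj, by linear_combination k * hab - q.num * hc⟩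

end Arithmetic

section Initial

variable {K : Type*} [Field K] {v : AddValuation K[X] (WithTop ℚ)} {φ f : K[X]} {lam : ℚ}

lemma digit_ne_zero_of_termVal_ne_top {i : ℕ} (hi : termVal v φ lam f i ≠ ⊤) : digit φ f i ≠ 0 :=
  mt termVal_of_digit_eq_zero hi

lemma mul_natDegree_le_of_digit_ne_zero (hφ : φ.Monic) {i : ℕ} (hi : digit φ f i ≠ 0) :
    i * φ.natDegree ≤ f.natDegree :=
  le_of_not_gt (mt (digit_eq_zero_of_natDegree_lt hφ) hi)

lemma IsKeyPoly.not_vDvd_pow_mul {O : Type*} [CommRing O] [Algebra O K] (hk : IsKeyPoly O v f)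
    {a : K[X]} (hφ : φ.natDegree < f.natDegree) (ha : a.natDegree < f.natDegree) (n : ℕ) :
    ¬ VDvd v f (φ ^ n * a) := fun h =>
  (hk.irreducible _ _ h).elim (fun h => hk.not_vDvd_of_natDegree_lt hφ (hk.vDvd_of_pow h))
    (hk.not_vDvd_of_natDegree_lt ha)

namespace Augmentable

lemma valuation_C (H : Augmentable v φ lam) (t : K) : H.valuation (C t) = v (C t) :=
  H.valuation_of_natDegree_lt ((natDegree_C t).symm ▸ H.natDegree_pos)

lemma valuation_pow_mul_digit (H : Augmentable v φ lam) (f : K[X]) (i : ℕ) :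
    H.valuation (φ ^ i * digit φ f i) = termVal v φ lam f i := by
  rw [H.valuation_pow_mul, H.valuation_of_natDegree_lt (H.digit_lt f i), termVal]

lemma termVal_ne_top (H : Augmentable v φ lam) (hf : f ≠ 0) {i : ℕ}
    (hi : IsInitial v φ lam f i) : termVal v φ lam f i ≠ ⊤ :=
  hi ▸ H.augment_ne_top hf

lemma digit_ne_zero (H : Augmentable v φ lam) (hf : f ≠ 0) {i : ℕ}
    (hi : IsInitial v φ lam f i) : digit φ f i ≠ 0 :=
  digit_ne_zero_of_termVal_ne_top (H.termVal_ne_top hf hi)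

lemma vEquiv_sum (H : Augmentable v φ lam) (hf : f ≠ 0) (p : ℕ → K[X])
    (hp : ∀ j, H.valuation f < H.valuation (φ ^ j * digit φ f j - p j)) :
    VEquiv H.valuation f (∑ j ∈ Finset.range (f.natDegree + 1), p j) := by
  refine VEquiv.of_lt ?_
  have hsum := sum_digit H.monic (natDegree_lt_succ_mul H.natDegree_pos f)
  rw [show f - ∑ j ∈ Finset.range (f.natDegree + 1), p j =
    ∑ j ∈ Finset.range (f.natDegree + 1), (φ ^ j * digit φ f j - p j) by
      rw [Finset.sum_sub_distrib, hsum]]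
  exact AddValuation.map_lt_sum _ (H.valuation_ne_top hf) fun j _ => hp j

lemma exists_lt_isInitial {O : Type*} [CommRing O] [Algebra O K] (H : Augmentable v φ lam)
    (hk : IsKeyPoly O H.valuation f) (hdeg : φ.natDegree < f.natDegree) :
    ∃ i j, i < j ∧ IsInitial v φ lam f i ∧ IsInitial v φ lam f j := by
  have hf := hk.monic.ne_zero
  obtain ⟨j, hj⟩ := exists_isInitial v φ lam f
  suffices h : ∃ i, i ≠ j ∧ IsInitial v φ lam f i by
    obtain ⟨i, hne, hi⟩ := h
    rcases lt_or_gt_of_ne hne with hij | hij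
    exacts [⟨i, j, hij, hi, hj⟩, ⟨j, i, hij, hj, hi⟩]
  by_contra! hne
  have hmem : j ∈ Finset.range (f.natDegree + 1) := Finset.mem_range_succ_iff.2
    ((Nat.le_mul_of_pos_right j H.natDegree_pos).trans
      (mul_natDegree_le_of_digit_ne_zero H.monic (H.digit_ne_zero hf hj)))
  have hE : VEquiv H.valuation f (φ ^ j * digit φ f j) := by
    rw [← Finset.sum_ite_eq_of_mem' _ j (fun k => φ ^ k * digit φ f k) hmem]
    refine H.vEquiv_sum hf _ fun k => ?_
    split_ifs with hkj
    · rw [sub_self, AddValuation.map_zero]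
      exact lt_top_iff_ne_top.2 (H.valuation_ne_top hf)
    · rw [sub_zero, H.valuation_pow_mul_digit]
      exact augment_lt_termVal H.monic H.natDegree_pos (hne k hkj)
  exact hk.not_vDvd_pow_mul hdeg ((H.digit_lt f j).trans hdeg) j
    ((VDvd.refl (H.valuation_ne_top hf)).of_vEquiv hE)

lemma mod_ne_zero (H : Augmentable v φ lam) {a b : K[X]} (ha : a ≠ 0) (hb : b ≠ 0)
    (had : a.natDegree < φ.natDegree) (hbd : b.natDegree < φ.natDegree) : (a * b) %ₘ φ ≠ 0 := by
  intro h0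
  have hmod := H.map_mod a b had hbd
  rw [h0, v.map_zero, eq_comm, WithTop.add_eq_top] at hmod
  exact hmod.elim (H.ne_top a ha had) (H.ne_top b hb hbd)

lemma vEquiv_mod (H : Augmentable v φ lam) {a b : K[X]} (ha : a ≠ 0) (hb : b ≠ 0)
    (had : a.natDegree < φ.natDegree) (hbd : b.natDegree < φ.natDegree) :
    VEquiv H.valuation (a * b) ((a * b) %ₘ φ) := by
  refine VEquiv.of_lt ?_
  have hdiv : a * b - (a * b) %ₘ φ = φ ^ 1 * ((a * b) /ₘ φ) := by
    rw [pow_one]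
    exact sub_eq_of_eq_add' (modByMonic_add_div (a * b) φ).symm
  rw [hdiv, H.valuation_pow_mul, H.valuation_of_natDegree_lt (H.natDegree_mul_div_lt had hbd),
    AddValuation.map_mul, H.valuation_of_natDegree_lt had, H.valuation_of_natDegree_lt hbd,
    Nat.cast_one, one_mul]
  exact H.lt_map_div a b ha hb had hbd

lemma exists_vEquiv_mul_pow (H : Augmentable v φ lam) {a b : K[X]} (ha : a ≠ 0) (hb : b ≠ 0)
    (had : a.natDegree < φ.natDegree) (hbd : b.natDegree < φ.natDegree) (n : ℕ) :
    ∃ r : K[X], r ≠ 0 ∧ r.natDegree < φ.natDegree ∧ VEquiv H.valuation (a * b ^ n) r := by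
  induction n with
  | zero =>
    rw [pow_zero, mul_one]
    exact ⟨a, ha, had, VEquiv.refl (H.valuation_ne_top ha)⟩
  | succ n ih =>
    obtain ⟨r, hr, hrd, hE⟩ := ih
    refine ⟨(b * r) %ₘ φ, H.mod_ne_zero hb hr hbd hrd, natDegree_modByMonic_lt _ H.monic
      (ne_one_of_natDegree_pos H.natDegree_pos), ?_⟩
    rw [pow_succ', mul_left_comm]
    exact (hE.mul_left (H.valuation_ne_top hb)).trans (H.vEquiv_mod hb hr hbd hrd)

end Augmentable

end Initial

section Residue

variable {R : Type*} [CommRing R] [IsLocalRing R]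

lemma exists_map_residue_eq_prod [IsAlgClosed (IsLocalRing.ResidueField R)] (T : R[X]) :
    ∃ (s : R) (m : Multiset R), (C s * (m.map fun a => X - C a).prod).map (IsLocalRing.residue R) =
      T.map (IsLocalRing.residue R) := by
  obtain ⟨lift, hlift⟩ := (IsLocalRing.residue_surjective (R := R)).hasRightInverse
  set Tb := T.map (IsLocalRing.residue R)
  refine ⟨lift Tb.leadingCoeff, Tb.roots.map lift, ?_⟩
  have hroots : (map (IsLocalRing.residue R) ∘ fun a => X - C a) ∘ lift = fun a => X - C a := by
    funext a
    simp only [Function.comp_apply, Polynomial.map_sub, map_X, map_C, hlift a]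
  rw [Polynomial.map_mul, map_C, hlift, Polynomial.map_multiset_prod, Multiset.map_map,
    Multiset.map_map, hroots, ← (IsAlgClosed.splits Tb).eq_prod_roots]

end Residue

section TotallyRamified

variable (O : Type*) [CommRing O] [IsDomain O] [IsDiscreteValuationRing O]
variable {K : Type*} [Field K] [Algebra O K] [IsFractionRing O K]

/-- On polynomials of degree less than `d`, the valuation `v` takes exactly the values `k / d`
with `k` an integer, and has no residue extension over `O`. -/
structure TotallyRamified (v : AddValuation K[X] (WithTop ℚ)) (d : ℕ) : Prop where
  map_C : ∀ t : K, v (C t) = ord O t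
  exists_int : ∀ a : K[X], a ≠ 0 → a.natDegree < d → ∃ k : ℤ, v a = ((k / d : ℚ) : WithTop ℚ)
  exists_poly : ∀ k : ℤ, ∃ a : K[X], a ≠ 0 ∧ a.natDegree < d ∧ v a = ((k / d : ℚ) : WithTop ℚ)
  exists_scalar : ∀ a b : K[X], a ≠ 0 → b ≠ 0 → a.natDegree < d → b.natDegree < d → v a = v b →
    ∃ t : O, v a < v (a - C (algebraMap O K t) * b)

variable (K) in
lemma totallyRamified_evalVal : TotallyRamified O (evalVal O : AddValuation K[X] _) 1 := by
  have hconst : ∀ a : K[X], a ≠ 0 → a.natDegree < 1 → ∃ x : K, x ≠ 0 ∧ a = C x := by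
    intro a ha hd
    have hC := eq_C_of_natDegree_eq_zero (Nat.lt_one_iff.1 hd)
    exact ⟨a.coeff 0, fun h0 => ha (by rw [hC, h0, C_0]), hC⟩
  refine ⟨evalVal_C O, fun a ha hd => ?_, fun k => ?_, fun a b ha hb had hbd hab => ?_⟩
  · obtain ⟨x, hx, rfl⟩ := hconst a ha hd
    exact ⟨ordInt O x, by rw [evalVal_C, ord_of_ne_zero O hx, Nat.cast_one, div_one]⟩
  · obtain ⟨p, hp, rfl⟩ := exists_ordInt_eq O K k
    refine ⟨C p, C_ne_zero.2 hp, (natDegree_C p).trans_lt one_pos, ?_⟩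
    rw [evalVal_C, ord_of_ne_zero O hp, Nat.cast_one, div_one]
  · obtain ⟨x, hx, rfl⟩ := hconst a ha had
    obtain ⟨y, hy, rfl⟩ := hconst b hb hbd
    have hxy : ord O (x / y) = 0 := by
      rw [evalVal_C, evalVal_C, ← div_mul_cancel₀ x hy, ord_mul,
        ord_of_ne_zero O (div_ne_zero hx hy), ord_of_ne_zero O hy, ← WithTop.coe_add,
        WithTop.coe_eq_coe, add_eq_right] at hab
      rw [ord_of_ne_zero O (div_ne_zero hx hy), hab, WithTop.coe_zero]
    obtain ⟨t, ht⟩ := (ord_nonneg_iff O).1 hxy.ge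
    refine ⟨t, ?_⟩
    rw [ht, ← C_mul, div_mul_cancel₀ x hy, sub_self, AddValuation.map_zero, evalVal_C,
      ord_of_ne_zero O hx]
    exact WithTop.coe_lt_top _

variable {O} {v : AddValuation K[X] (WithTop ℚ)} {φ f : K[X]} {lam : ℚ}

lemma map_aeval_pos (hC : ∀ t : K, v (C t) = ord O t) {y : K[X]} (hy : v y = 0) {p : O[X]}
    (hp : p.map (IsLocalRing.residue O) = 0) : 0 < v (aeval y p) := by
  rw [aeval_eq_sum_range]
  refine v.map_lt_sum WithTop.zero_ne_top fun i _ => ?_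
  rw [Algebra.smul_def, Polynomial.algebraMap_apply, v.map_mul, v.map_pow, hy, hC, smul_zero,
    add_zero, ord_algebraMap_pos_iff, ← IsLocalRing.residue_eq_zero_iff, ← coeff_map, hp,
    coeff_zero]

lemma IsKeyPoly.exists_vDvd_sub_C [IsAlgClosed (IsLocalRing.ResidueField O)]
    (hk : IsKeyPoly O v f) (hC : ∀ t : K, v (C t) = ord O t) {y : K[X]} (hy : v y = 0) {T : O[X]}
    (hT : v (aeval y T) = 0) (hdvd : VDvd v f (aeval y T)) :
    ∃ s : O, VDvd v f (y - C (algebraMap O K s)) := by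
  obtain ⟨s, m, hm⟩ := exists_map_residue_eq_prod T
  have hE : VEquiv v (aeval y T) (aeval y (C s * (m.map fun a => X - C a).prod)) := by
    refine VEquiv.of_lt ?_
    rw [hT, ← map_sub]
    exact map_aeval_pos hC hy (by rw [Polynomial.map_sub, hm, sub_self])
  have hprod := hdvd.of_vEquiv hE
  rw [map_mul, aeval_C, map_multiset_prod, Multiset.map_map] at hprod
  have hs : ¬ VDvd v f (algebraMap O K[X] s) := hk.not_vDvd_of_natDegree_lt
    (by rw [Polynomial.algebraMap_apply, natDegree_C]; exact hk.natDegree_pos)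
  obtain ⟨g, hg, hgd⟩ := hk.exists_vDvd_of_prod _ ((hk.irreducible _ _ hprod).resolve_left hs)
  obtain ⟨a, -, rfl⟩ := Multiset.mem_map.1 hg
  rw [Function.comp_apply, map_sub, aeval_X, aeval_C, Polynomial.algebraMap_apply] at hgd
  exact ⟨a, hgd⟩

namespace TotallyRamified

lemma exists_int_termVal (S : TotallyRamified O v φ.natDegree) (hφ : φ.Monic)
    (hd : 0 < φ.natDegree) {i : ℕ} (hi : termVal v φ lam f i ≠ ⊤) :
    ∃ k : ℤ, termVal v φ lam f i = ((k / φ.natDegree + i * lam : ℚ) : WithTop ℚ) := by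
  obtain ⟨k, hk⟩ := S.exists_int _ (digit_ne_zero_of_termVal_ne_top hi)
    (natDegree_digit_lt hφ hd f i)
  exact ⟨k, by rw [termVal, hk, ← WithTop.coe_add]⟩

lemma den_dvd_sub (S : TotallyRamified O v φ.natDegree) (hφ : φ.Monic) (hd : 0 < φ.natDegree)
    {g : K[X]} {i j : ℕ} (hi : termVal v φ lam f i ≠ ⊤)
    (hij : termVal v φ lam f i = termVal v φ lam g j) :
    ((φ.natDegree * lam).den : ℤ) ∣ (i : ℤ) - j := by
  obtain ⟨k, hk⟩ := S.exists_int_termVal hφ hd hi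
  obtain ⟨l, hl⟩ := S.exists_int_termVal hφ hd (hij ▸ hi)
  rw [hk, hl, WithTop.coe_eq_coe] at hij
  have hd' : (φ.natDegree : ℚ) ≠ 0 := Nat.cast_ne_zero.2 hd.ne'
  refine den_dvd_of_mul_eq_intCast (l := l - k) ?_
  field_simp at hij
  push_cast
  linear_combination hij

end TotallyRamified

namespace Augmentable

lemma exists_scalar_mul_pow (H : Augmentable v φ lam) (S : TotallyRamified O v φ.natDegree)
    {a b c : K[X]} (ha : a ≠ 0) (hb : b ≠ 0) (hc : c ≠ 0) (had : a.natDegree < φ.natDegree)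
    (hbd : b.natDegree < φ.natDegree) (hcd : c.natDegree < φ.natDegree) (n : ℕ)
    (hval : H.valuation (a * b ^ n) = v c) :
    ∃ t : O, v c < H.valuation (c - C (algebraMap O K t) * (a * b ^ n)) := by
  obtain ⟨r, hr, hrd, hE⟩ := H.exists_vEquiv_mul_pow ha hb had hbd n
  have hcr : v c = v r := by rw [← hval, hE.1, H.valuation_of_natDegree_lt hrd]
  obtain ⟨t, ht⟩ := S.exists_scalar c r hc hr hcd hrd hcr
  refine ⟨t, ?_⟩
  rw [show c - C (algebraMap O K t) * (a * b ^ n) =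
    (c - C (algebraMap O K t) * r) + C (algebraMap O K t) * (r - a * b ^ n) by ring]
  apply AddValuation.map_lt_add
  · rwa [H.valuation_of_natDegree_lt]
    exact (natDegree_sub_le _ _).trans_lt (max_lt hcd ((natDegree_C_mul_le _ _).trans_lt hrd))
  · rw [AddValuation.map_mul, H.valuation_C, S.map_C, ← hval, AddValuation.map_sub_swap]
    exact hE.2.trans_le (le_add_of_nonneg_left (ord_algebraMap_nonneg O t))

lemma exists_mul_vEquiv_one (H : Augmentable v φ lam) (S : TotallyRamified O v φ.natDegree)
    {b : K[X]} (hb : b ≠ 0) (hbd : b.natDegree < φ.natDegree) :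
    ∃ c : K[X], c.natDegree < φ.natDegree ∧ VEquiv H.valuation (c * b) 1 := by
  obtain ⟨k, hk⟩ := S.exists_int b hb hbd
  obtain ⟨c, hc, hcd, hvc⟩ := S.exists_poly (-k)
  have hcb : H.valuation (c * b ^ 1) = v 1 := by
    rw [pow_one, AddValuation.map_mul, H.valuation_of_natDegree_lt hcd,
      H.valuation_of_natDegree_lt hbd, hvc, hk, ← WithTop.coe_add, v.map_one, Int.cast_neg,
      neg_div, neg_add_cancel, WithTop.coe_zero]
  obtain ⟨t, ht⟩ := H.exists_scalar_mul_pow S hc hb one_ne_zero hcd hbd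
    (natDegree_one_lt H.natDegree_pos) 1 hcb
  refine ⟨C (algebraMap O K t) * c, (natDegree_C_mul_le _ _).trans_lt hcd, VEquiv.symm ?_⟩
  refine VEquiv.of_lt ?_
  rwa [AddValuation.map_one, mul_assoc, ← v.map_one, ← pow_one b]

lemma exists_valuation_pow_mul_eq_zero (H : Augmentable v φ lam)
    (S : TotallyRamified O v φ.natDegree) :
    ∃ b : K[X], b ≠ 0 ∧ b.natDegree < φ.natDegree ∧
      H.valuation (φ ^ (φ.natDegree * lam).den * b) = 0 := by
  obtain ⟨b, hb, hbd, hvb⟩ := S.exists_poly (-(φ.natDegree * lam).num)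
  refine ⟨b, hb, hbd, ?_⟩
  have hd' : (φ.natDegree : ℚ) ≠ 0 := Nat.cast_ne_zero.2 H.natDegree_pos.ne'
  rw [H.valuation_pow_mul, H.valuation_of_natDegree_lt hbd, hvb, ← WithTop.coe_add, Int.cast_neg,
    ← Rat.mul_den_eq_num]
  refine (WithTop.coe_eq_coe (b := 0)).2 ?_
  field_simp
  ring

lemma exists_lt_valuation_sub_aeval (H : Augmentable v φ lam)
    (S : TotallyRamified O v φ.natDegree) (hf : f ≠ 0) {i j : ℕ} (hij : i ≤ j)
    (hi : IsInitial v φ lam f i) (hj : IsInitial v φ lam f j) {b : K[X]} (hb : b ≠ 0)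
    (hbd : b.natDegree < φ.natDegree) (hy : H.valuation (φ ^ (φ.natDegree * lam).den * b) = 0) :
    ∃ p : O[X], H.valuation f < H.valuation (φ ^ j * digit φ f j -
      φ ^ i * digit φ f i * aeval (φ ^ (φ.natDegree * lam).den * b) p) := by
  set e := (φ.natDegree * lam).den
  have hVi : H.valuation f = termVal v φ lam f i := hi
  have hVj : H.valuation f = termVal v φ lam f j := hj
  obtain ⟨n, hn⟩ : e ∣ j - i := by
    rw [← Int.natCast_dvd_natCast, Nat.cast_sub hij]
    exact S.den_dvd_sub H.monic H.natDegree_pos (H.termVal_ne_top hf hj) (hVj.symm.trans hVi)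
  obtain rfl : j = i + e * n := by omega
  have hpow : ∀ q : K[X], φ ^ (i + e * n) * (q * (digit φ f i * b ^ n)) =
      φ ^ i * digit φ f i * (q * (φ ^ e * b) ^ n) := fun q => by ring
  have hval : H.valuation (digit φ f i * b ^ n) = v (digit φ f (i + e * n)) := by
    refine WithTop.add_right_cancel (z := (((i + e * n : ℕ) * lam : ℚ) : WithTop ℚ))
      WithTop.coe_ne_top ?_
    have hpow' := hpow 1
    rw [one_mul, one_mul] at hpow'
    rw [← H.valuation_pow_mul, hpow', AddValuation.map_mul, AddValuation.map_pow, hy, smul_zero,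
      add_zero, H.valuation_pow_mul_digit, ← hVi, hVj, termVal]
  obtain ⟨t, ht⟩ := H.exists_scalar_mul_pow S (H.digit_ne_zero hf hi) hb (H.digit_ne_zero hf hj)
    (H.digit_lt f i) hbd (H.digit_lt f _) n hval
  refine ⟨monomial n t, ?_⟩
  rw [aeval_monomial, Polynomial.algebraMap_apply, ← hpow, ← mul_sub, H.valuation_pow_mul, hVj]
  exact WithTop.add_lt_add_right WithTop.coe_ne_top ht

lemma exists_vEquiv_aeval (H : Augmentable v φ lam) (S : TotallyRamified O v φ.natDegree)
    (hf : f ≠ 0) {b : K[X]} (hb : b ≠ 0) (hbd : b.natDegree < φ.natDegree)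
    (hy : H.valuation (φ ^ (φ.natDegree * lam).den * b) = 0) :
    ∃ (i : ℕ) (T : O[X]), IsInitial v φ lam f i ∧ VEquiv H.valuation f
      (φ ^ i * digit φ f i * aeval (φ ^ (φ.natDegree * lam).den * b) T) := by
  classical
  have hex := exists_isInitial v φ lam f
  have hterm : ∀ j, ∃ p : O[X], H.valuation f < H.valuation (φ ^ j * digit φ f j -
      φ ^ Nat.find hex * digit φ f (Nat.find hex) *
        aeval (φ ^ (φ.natDegree * lam).den * b) p) := by
    intro j
    by_cases hj : IsInitial v φ lam f j
    · exact H.exists_lt_valuation_sub_aeval S hf (Nat.find_min' hex hj) (Nat.find_spec hex) hj hb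
        hbd hy
    · refine ⟨0, ?_⟩
      rw [map_zero, mul_zero, sub_zero, H.valuation_pow_mul_digit]
      exact augment_lt_termVal H.monic H.natDegree_pos hj
  choose p hp using hterm
  refine ⟨Nat.find hex, ∑ j ∈ Finset.range (f.natDegree + 1), p j, Nat.find_spec hex, ?_⟩
  rw [map_sum, Finset.mul_sum]
  exact H.vEquiv_sum hf _ hp

lemma exists_vDvd_sub_C [IsAlgClosed (IsLocalRing.ResidueField O)] (H : Augmentable v φ lam)
    (S : TotallyRamified O v φ.natDegree) (hk : IsKeyPoly O H.valuation f)
    (hdeg : φ.natDegree < f.natDegree) {b : K[X]} (hb : b ≠ 0) (hbd : b.natDegree < φ.natDegree)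
    (hy : H.valuation (φ ^ (φ.natDegree * lam).den * b) = 0) :
    ∃ s : O, VDvd H.valuation f (φ ^ (φ.natDegree * lam).den * b - C (algebraMap O K s)) := by
  have hf := hk.monic.ne_zero
  obtain ⟨i, T, hi, hT⟩ := H.exists_vEquiv_aeval S hf hb hbd hy
  have hVi : H.valuation f = termVal v φ lam f i := hi
  have hT0 : H.valuation (aeval (φ ^ (φ.natDegree * lam).den * b) T) = 0 := by
    have hmul := hT.1
    rw [AddValuation.map_mul, H.valuation_pow_mul_digit, ← hVi] at hmul
    exact WithTop.add_left_cancel (H.valuation_ne_top hf) (by rw [← hmul, add_zero])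
  have hdvd := (VDvd.refl (H.valuation_ne_top hf)).of_vEquiv hT
  exact hk.exists_vDvd_sub_C (fun t => by rw [H.valuation_C, S.map_C]) hy hT0
    ((hk.irreducible _ _ hdvd).resolve_left
      (hk.not_vDvd_pow_mul hdeg ((H.digit_lt f i).trans hdeg) i))

lemma valuation_pow_mul_sub_C_le (H : Augmentable v φ lam) {b : K[X]}
    (hbd : b.natDegree < φ.natDegree) {n : ℕ} (hn : n ≠ 0) (s : K) :
    H.valuation (φ ^ n * b - C s) ≤ H.valuation (φ ^ n * b) := by
  refine (augment_le H.monic H.natDegree_pos _ n).trans_eq ?_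
  have hs : (C s).natDegree < φ.natDegree := (natDegree_C s).symm ▸ H.natDegree_pos
  rw [termVal, digit_sub H.monic, digit_pow_mul_of_natDegree_lt H.monic hbd, if_pos rfl,
    digit_of_natDegree_lt H.monic hs, if_neg hn, sub_zero, H.valuation_pow_mul,
    H.valuation_of_natDegree_lt hbd]

lemma natDegree_le_of_isKeyPoly [IsAlgClosed (IsLocalRing.ResidueField O)]
    (H : Augmentable v φ lam) (S : TotallyRamified O v φ.natDegree)
    (hk : IsKeyPoly O H.valuation f) (hdeg : φ.natDegree < f.natDegree) :
    f.natDegree ≤ (φ.natDegree * lam).den * φ.natDegree := by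
  obtain ⟨b, hb, hbd, hy⟩ := H.exists_valuation_pow_mul_eq_zero S
  obtain ⟨s, hs⟩ := H.exists_vDvd_sub_C S hk hdeg hb hbd hy
  obtain ⟨c, hcd, hcb⟩ := H.exists_mul_vEquiv_one S hb hbd
  set e := (φ.natDegree * lam).den
  have hc : H.valuation c ≠ ⊤ := fun h => hcb.ne_top (by rw [AddValuation.map_mul, h, top_add])
  have hφe : H.valuation (φ ^ e) ≠ ⊤ := H.valuation_ne_top (pow_ne_zero e H.monic.ne_zero)
  have hE : VEquiv H.valuation (c * (φ ^ e * b - C (algebraMap O K s)))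
      (φ ^ e - C (algebraMap O K s) * c) := by
    refine VEquiv.of_lt ?_
    calc H.valuation (c * (φ ^ e * b - C (algebraMap O K s)))
        ≤ H.valuation (c * (φ ^ e * b)) := by
          rw [AddValuation.map_mul, AddValuation.map_mul]
          gcongr
          exact H.valuation_pow_mul_sub_C_le hbd (Rat.den_ne_zero _) _
      _ = H.valuation (φ ^ e * (c * b)) := by rw [mul_left_comm]
      _ < H.valuation (φ ^ e * (c * b) - φ ^ e * 1) := (hcb.mul_left hφe).2
      _ = H.valuation (c * (φ ^ e * b - C (algebraMap O K s)) -
            (φ ^ e - C (algebraMap O K s) * c)) := by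
          congr 1
          ring
  refine (hk.minimal _ ((hs.mul_left hc).of_vEquiv hE)).trans ?_
  refine (natDegree_sub_le _ _).trans (max_le natDegree_pow_le ?_)
  exact (natDegree_C_mul_le _ _).trans (hcd.le.trans (Nat.le_mul_of_pos_left _ (Rat.den_pos _)))

lemma natDegree_eq_of_isKeyPoly [IsAlgClosed (IsLocalRing.ResidueField O)]
    (H : Augmentable v φ lam) (S : TotallyRamified O v φ.natDegree)
    (hk : IsKeyPoly O H.valuation f) (hdeg : φ.natDegree < f.natDegree) :
    f.natDegree = (φ.natDegree * lam).den * φ.natDegree ∧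
    H.valuation f = (((φ.natDegree * lam).den * lam : ℚ) : WithTop ℚ) ∧
    v (f %ₘ φ) = (((φ.natDegree * lam).den * lam : ℚ) : WithTop ℚ) := by
  have hf := hk.monic.ne_zero
  have hle := H.natDegree_le_of_isKeyPoly S hk hdeg
  obtain ⟨i, j, hij, hi, hj⟩ := H.exists_lt_isInitial hk hdeg
  have hVi : H.valuation f = termVal v φ lam f i := hi
  have hVj : H.valuation f = termVal v φ lam f j := hj
  set e := (φ.natDegree * lam).den
  have hdvd : e ∣ j - i := by
    rw [← Int.natCast_dvd_natCast, Nat.cast_sub hij.le]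
    exact S.den_dvd_sub H.monic H.natDegree_pos (H.termVal_ne_top hf hj) (hVj.symm.trans hVi)
  have hjle := mul_natDegree_le_of_digit_ne_zero H.monic (H.digit_ne_zero hf hj)
  have hje : j ≤ e := Nat.le_of_mul_le_mul_right (hjle.trans hle) H.natDegree_pos
  have heij := Nat.le_of_dvd (Nat.sub_pos_of_lt hij) hdvd
  obtain rfl : i = 0 := by omega
  obtain rfl : j = e := by omega
  have hfd := le_antisymm hle hjle
  rw [termVal, digit_of_natDegree_eq H.monic H.natDegree_pos hk.monic hfd, v.map_one,
    zero_add] at hVj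
  rw [hVj, termVal, digit_zero_right, Nat.cast_zero, zero_mul, WithTop.coe_zero, add_zero] at hVi
  exact ⟨hfd, hVj, hVi.symm⟩

lemma isInitial_unique (H : Augmentable v φ lam) (S : TotallyRamified O v φ.natDegree)
    {a b : K[X]} (ha : a ≠ 0) (hb : b ≠ 0)
    (had : a.natDegree < (φ.natDegree * lam).den * φ.natDegree)
    (hbd : b.natDegree < (φ.natDegree * lam).den * φ.natDegree)
    (hab : H.valuation a = H.valuation b) {i j : ℕ} (hi : IsInitial v φ lam a i)
    (hj : IsInitial v φ lam b j) : i = j := by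
  have hij := S.den_dvd_sub H.monic H.natDegree_pos (H.termVal_ne_top ha hi)
    (hi.symm.trans (hab.trans hj))
  have hlt : ∀ {g : K[X]} {k : ℕ}, g ≠ 0 → IsInitial v φ lam g k →
      g.natDegree < (φ.natDegree * lam).den * φ.natDegree → k < (φ.natDegree * lam).den :=
    fun hg hk hgd => Nat.lt_of_mul_lt_mul_right
      ((mul_natDegree_le_of_digit_ne_zero H.monic (H.digit_ne_zero hg hk)).trans_lt hgd)
  have hi' := hlt ha hi had
  have hj' := hlt hb hj hbd
  have hzero : (i : ℤ) - j = 0 := Int.eq_zero_of_abs_lt_dvd hij (by rw [abs_lt]; omega)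
  omega

lemma exists_int_valuation (H : Augmentable v φ lam) (S : TotallyRamified O v φ.natDegree)
    (hf : f ≠ 0) : ∃ k : ℤ, H.valuation f =
      ((k / ((φ.natDegree * lam).den * φ.natDegree : ℕ) : ℚ) : WithTop ℚ) := by
  obtain ⟨j, hj⟩ := exists_isInitial v φ lam f
  obtain ⟨k, hk⟩ := S.exists_int_termVal H.monic H.natDegree_pos (H.termVal_ne_top hf hj)
  have hd' : (φ.natDegree : ℚ) ≠ 0 := Nat.cast_ne_zero.2 H.natDegree_pos.ne'
  have he' : ((φ.natDegree * lam).den : ℚ) ≠ 0 := Nat.cast_ne_zero.2 (Rat.den_ne_zero _)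
  refine ⟨k * (φ.natDegree * lam).den + j * (φ.natDegree * lam).num,
    (hj.trans hk).trans (WithTop.coe_eq_coe.2 ?_)⟩
  push_cast
  rw [← Rat.mul_den_eq_num]
  field_simp

lemma exists_poly_valuation (H : Augmentable v φ lam) (S : TotallyRamified O v φ.natDegree)
    (k : ℤ) : ∃ a : K[X], a ≠ 0 ∧ a.natDegree < (φ.natDegree * lam).den * φ.natDegree ∧
      H.valuation a = ((k / ((φ.natDegree * lam).den * φ.natDegree : ℕ) : ℚ) : WithTop ℚ) := by
  obtain ⟨j, l, hj, hjl⟩ := exists_lt_den_mul_num_add (φ.natDegree * lam) k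
  obtain ⟨a, ha, had, hva⟩ := S.exists_poly l
  have hφj := pow_ne_zero j H.monic.ne_zero
  have hd' : (φ.natDegree : ℚ) ≠ 0 := Nat.cast_ne_zero.2 H.natDegree_pos.ne'
  have he' : ((φ.natDegree * lam).den : ℚ) ≠ 0 := Nat.cast_ne_zero.2 (Rat.den_ne_zero _)
  refine ⟨φ ^ j * a, mul_ne_zero hφj ha, ?_, ?_⟩
  · calc (φ ^ j * a).natDegree = j * φ.natDegree + a.natDegree := by
          rw [natDegree_mul hφj ha, natDegree_pow]
      _ < (j + 1) * φ.natDegree := by rw [add_one_mul]; gcongr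
      _ ≤ (φ.natDegree * lam).den * φ.natDegree := by gcongr; exact hj
  · rw [H.valuation_pow_mul, H.valuation_of_natDegree_lt had, hva, ← WithTop.coe_add,
      WithTop.coe_eq_coe, ← hjl]
    push_cast
    rw [← Rat.mul_den_eq_num]
    field_simp
    ring

lemma exists_scalar_valuation (H : Augmentable v φ lam) (S : TotallyRamified O v φ.natDegree)
    {a b : K[X]} (ha : a ≠ 0) (hb : b ≠ 0)
    (had : a.natDegree < (φ.natDegree * lam).den * φ.natDegree)
    (hbd : b.natDegree < (φ.natDegree * lam).den * φ.natDegree)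
    (hab : H.valuation a = H.valuation b) :
    ∃ t : O, H.valuation a < H.valuation (a - C (algebraMap O K t) * b) := by
  obtain ⟨i, hi⟩ := exists_isInitial v φ lam a
  obtain ⟨j, hj⟩ := exists_isInitial v φ lam b
  obtain rfl : i = j := H.isInitial_unique S ha hb had hbd hab hi hj
  have hVa : H.valuation a = termVal v φ lam a i := hi
  have hVb : H.valuation b = termVal v φ lam b i := hj
  have hvi : v (digit φ a i) = v (digit φ b i) :=
    WithTop.add_right_cancel WithTop.coe_ne_top (hVa.symm.trans (hab.trans hVb))
  obtain ⟨t, ht⟩ := S.exists_scalar _ _ (H.digit_ne_zero ha hi) (H.digit_ne_zero hb hj)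
    (H.digit_lt a i) (H.digit_lt b i) hvi
  refine ⟨t, ?_⟩
  obtain ⟨k, hk⟩ := exists_isInitial v φ lam (a - C (algebraMap O K t) * b)
  refine lt_of_lt_of_eq ?_ hk.symm
  rcases eq_or_ne k i with rfl | hki
  · rw [hVa, termVal, termVal, digit_sub H.monic, digit_C_mul H.monic]
    exact WithTop.add_lt_add_right WithTop.coe_ne_top ht
  have hak : H.valuation a < termVal v φ lam a k := augment_lt_termVal H.monic H.natDegree_pos
    fun h => hki (H.isInitial_unique S ha ha had had rfl h hi)
  have hbk : H.valuation a < termVal v φ lam b k := hab.trans_lt <|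
    augment_lt_termVal H.monic H.natDegree_pos
      fun h => hki (H.isInitial_unique S hb hb hbd hbd rfl h hj)
  have htb : v (digit φ b k) ≤ v (C (algebraMap O K t) * digit φ b k) := by
    rw [v.map_mul, S.map_C]
    exact le_add_of_nonneg_left (ord_algebraMap_nonneg O t)
  calc H.valuation a < min (termVal v φ lam a k) (termVal v φ lam b k) := lt_min hak hbk
    _ = min (v (digit φ a k)) (v (digit φ b k)) + ((k * lam : ℚ) : WithTop ℚ) :=
        min_add_add_right _ _ _
    _ ≤ termVal v φ lam (a - C (algebraMap O K t) * b) k := by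
        rw [termVal, digit_sub H.monic, digit_C_mul H.monic]
        gcongr
        exact v.map_le_sub (min_le_left _ _) ((min_le_right _ _).trans htb)

lemma totallyRamified (H : Augmentable v φ lam) (S : TotallyRamified O v φ.natDegree) :
    TotallyRamified O H.valuation ((φ.natDegree * lam).den * φ.natDegree) where
  map_C t := (H.valuation_C t).trans (S.map_C t)
  exists_int _ ha _ := H.exists_int_valuation S ha
  exists_poly := H.exists_poly_valuation S
  exists_scalar _ _ ha hb had hbd hab := H.exists_scalar_valuation S ha hb had hbd hab

end Augmentable

end TotallyRamified

section Chain

variable (O : Type*) [CommRing O] [IsDomain O] [IsDiscreteValuationRing O]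
variable {K : Type*} [Field K] [Algebra O K] [IsFractionRing O K]

/-- A Mac Lane valuation `[v_0, v_1(φ 1) = lam 1, …, v_n(φ n) = lam n]` together with a proper key
polynomial over it, stored as `φ (n + 1)` so that it is treated like the `φ i`. -/
structure KeyChain (n : ℕ) (φ : ℕ → K[X]) (lam : ℕ → ℚ) : Prop where
  key : ∀ i ≤ n, IsKeyPoly O (val O φ lam i) (φ (i + 1))
  val_lt : ∀ i < n, val O φ lam i (φ (i + 1)) < (lam (i + 1) : WithTop ℚ)
  natDegree_lt : ∀ i < n, (φ (i + 1)).natDegree < (φ (i + 2)).natDegree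

/-- The ramification index of the `i`-th augmentation: the order of `lam i` modulo the value group
`(1 / deg (φ i)) ℤ` of the previous valuation. -/
def ramIdx (φ : ℕ → K[X]) (lam : ℕ → ℚ) (i : ℕ) : ℕ := ((φ i).natDegree * lam i).den

variable {O} {n : ℕ} {φ : ℕ → K[X]} {lam : ℕ → ℚ} {i : ℕ}

lemma gauss_nonneg {f : K[X]} (hf : f ∈ Polynomial.lifts (algebraMap O K)) : 0 ≤ gauss O f := by
  obtain ⟨g, rfl⟩ := (mem_lifts _).1 hf
  exact Finset.le_inf fun j _ => (coeff_map (algebraMap O K) j).symm ▸ ord_algebraMap_nonneg O _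

lemma val_congr {φ' : ℕ → K[X]} (h : ∀ j ≤ i, φ' j = φ j) :
    val O φ' lam i = val O φ lam i := by
  induction i with
  | zero => rfl
  | succ i ih => rw [val, val, ih fun j hj => h j (by omega), h _ le_rfl]

lemma IsMacLane.keyChain (hv : IsMacLane O n φ lam) (hn : n ≠ 0) {f : K[X]}
    (hf : IsProperKeyPoly O n φ lam f) : KeyChain O n (Function.update φ (n + 1) f) lam := by
  have hupd : ∀ j ≤ n, Function.update φ (n + 1) f j = φ j := fun j hj =>
    Function.update_of_ne (by omega) _ _
  have hval : ∀ i ≤ n, val O (Function.update φ (n + 1) f) lam i = val O φ lam i := fun i hi =>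
    val_congr fun j hj => hupd j (hj.trans hi)
  refine ⟨fun i hi => ?_, fun i hi => ?_, fun i hi => ?_⟩
  · rw [hval i hi]
    rcases hi.lt_or_eq with h | rfl
    · rw [hupd _ h]
      exact hv.key i h
    · rw [Function.update_self]
      exact hf.1
  · rw [hval i hi.le, hupd _ hi]
    exact hv.val_lt i hi
  · rw [hupd _ hi]
    rcases Nat.lt_or_ge (i + 1) n with h | h
    · rw [hupd _ h]
      exact hv.natDegree_lt (i + 1) (by omega) h
    · obtain rfl : n = i + 1 := by omega
      rw [Function.update_self]
      exact hf.2.resolve_left hn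

namespace KeyChain

variable (h : KeyChain O n φ lam)
include h

lemma isKeyPoly_coe (hi : i ≤ n) {V : AddValuation K[X] (WithTop ℚ)} (hV : ⇑V = val O φ lam i) :
    IsKeyPoly O V (φ (i + 1)) :=
  hV ▸ h.key i hi

lemma monic (hi : i ≤ n) : (φ (i + 1)).Monic :=
  (h.key i hi).monic

lemma natDegree_pos (hi : i ≤ n) : 0 < (φ (i + 1)).natDegree :=
  (h.key i hi).natDegree_pos

lemma exists_augmentable_of_coe_eq_val (hi : i < n) {V : AddValuation K[X] (WithTop ℚ)}
    (hV : ⇑V = val O φ lam i) (htop : ∀ f : K[X], f ≠ 0 → V f ≠ ⊤) :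
    ∃ H : Augmentable V (φ (i + 1)) (lam (i + 1)), ⇑H.valuation = val O φ lam (i + 1) := by
  refine ⟨(h.isKeyPoly_coe hi.le hV).augmentable htop (hV ▸ h.val_lt i hi), ?_⟩
  rw [Augmentable.coe_valuation, hV, val]

variable [IsAlgClosed (IsLocalRing.ResidueField O)]

lemma natDegree_one : (φ 1).natDegree = 1 := by
  have hk := h.isKeyPoly_coe (V := (augmentable_X O).valuation) n.zero_le
    (gauss_eq_augment O).symm
  refine (le_of_not_gt fun hlt => ?_).antisymm (h.natDegree_pos n.zero_le)
  have S : TotallyRamified O (evalVal O) (X : K[X]).natDegree :=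
    natDegree_X (R := K) ▸ totallyRamified_evalVal O K
  have hdeg := ((augmentable_X O).natDegree_eq_of_isKeyPoly S hk
    (natDegree_X.trans_lt hlt)).1
  rw [mul_zero, Rat.den_zero, one_mul, natDegree_X] at hdeg
  exact hlt.ne' hdeg

lemma exists_valuation (hi : i ≤ n) :
    ∃ V : AddValuation K[X] (WithTop ℚ), ⇑V = val O φ lam i ∧ (∀ f : K[X], f ≠ 0 → V f ≠ ⊤) ∧
      TotallyRamified O V (φ (i + 1)).natDegree := by
  induction i with
  | zero =>
    have S := (augmentable_X O).totallyRamified (natDegree_X (R := K) ▸ totallyRamified_evalVal O K)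
    rw [mul_zero, Rat.den_zero, one_mul, natDegree_X, ← h.natDegree_one] at S
    exact ⟨_, (gauss_eq_augment O).symm, fun f hf => (augmentable_X O).valuation_ne_top hf, S⟩
  | succ i ih =>
    obtain ⟨V, hV, htop, S⟩ := ih (by omega)
    obtain ⟨H, hV'⟩ := h.exists_augmentable_of_coe_eq_val hi hV htop
    refine ⟨H.valuation, hV', fun f hf => H.valuation_ne_top hf, ?_⟩
    rw [(H.natDegree_eq_of_isKeyPoly S (h.isKeyPoly_coe hi hV') (h.natDegree_lt i hi)).1]
    exact H.totallyRamified S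

lemma exists_augmentable (hi : i < n) :
    ∃ (V : AddValuation K[X] (WithTop ℚ)) (H : Augmentable V (φ (i + 1)) (lam (i + 1))),
      ⇑V = val O φ lam i ∧ ⇑H.valuation = val O φ lam (i + 1) ∧
        TotallyRamified O V (φ (i + 1)).natDegree := by
  obtain ⟨V, hV, htop, S⟩ := h.exists_valuation hi.le
  obtain ⟨H, hV'⟩ := h.exists_augmentable_of_coe_eq_val hi hV htop
  exact ⟨V, H, hV, hV', S⟩

lemma natDegree_succ (hi : i < n) :
    (φ (i + 2)).natDegree = ramIdx φ lam (i + 1) * (φ (i + 1)).natDegree := by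
  obtain ⟨V, H, -, hV', S⟩ := h.exists_augmentable hi
  exact (H.natDegree_eq_of_isKeyPoly S (h.isKeyPoly_coe hi hV') (h.natDegree_lt i hi)).1

lemma val_succ (hi : i < n) :
    val O φ lam (i + 1) (φ (i + 2)) =
      ((ramIdx φ lam (i + 1) * lam (i + 1) : ℚ) : WithTop ℚ) := by
  obtain ⟨V, H, -, hV', S⟩ := h.exists_augmentable hi
  rw [← hV']
  exact (H.natDegree_eq_of_isKeyPoly S (h.isKeyPoly_coe hi hV') (h.natDegree_lt i hi)).2.1

lemma val_mod (hi : i < n) :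
    val O φ lam i (φ (i + 2) %ₘ φ (i + 1)) =
      ((ramIdx φ lam (i + 1) * lam (i + 1) : ℚ) : WithTop ℚ) := by
  obtain ⟨V, H, hV, hV', S⟩ := h.exists_augmentable hi
  rw [← hV]
  exact (H.natDegree_eq_of_isKeyPoly S (h.isKeyPoly_coe hi hV') (h.natDegree_lt i hi)).2.2

lemma two_le_ramIdx (hi : i < n) : 2 ≤ ramIdx φ lam (i + 1) := by
  have hlt := h.natDegree_lt i hi
  rw [h.natDegree_succ hi] at hlt
  exact (lt_mul_iff_one_lt_left (h.natDegree_pos hi.le)).1 hlt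

lemma ramIdx_mul_lam_lt (hi : i + 1 < n) :
    ramIdx φ lam (i + 1) * lam (i + 1) < lam (i + 2) := by
  have hlt := h.val_lt (i + 1) hi
  rw [h.val_succ (by omega)] at hlt
  exact WithTop.coe_lt_coe.1 hlt

lemma lam_pos (hi : i < n) : 0 < lam (i + 1) := by
  induction i with
  | zero =>
    have hgauss : 0 ≤ val O φ lam 0 (φ 1) := gauss_nonneg (h.key 0 n.zero_le).integral
    exact_mod_cast hgauss.trans_lt (h.val_lt 0 hi)
  | succ i ih =>
    have hpos := ih (by omega)
    exact lt_of_le_of_lt (by positivity) (h.ramIdx_mul_lam_lt hi)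

end KeyChain

end Chain

section Root

lemma coe_mul_le_add_of_le {x : WithTop ℚ} {j M : ℕ} {c l : ℚ} (hj : j ≤ M) (hcl : c ≤ l)
    (h : ((M * l : ℚ) : WithTop ℚ) ≤ x + ((j * l : ℚ) : WithTop ℚ)) :
    ((M * c : ℚ) : WithTop ℚ) ≤ x + ((j * c : ℚ) : WithTop ℚ) := by
  induction x with
  | top => rw [top_add]; exact le_top
  | coe q =>
    norm_cast at h ⊢
    have hj' : (j : ℚ) ≤ M := by exact_mod_cast hj
    linarith [mul_le_mul_of_nonneg_left hcl (sub_nonneg.2 hj')]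

variable {O : Type*} [CommRing O] [IsDomain O] [IsDiscreteValuationRing O]
variable {K : Type*} [Field K] [Algebra O K] [IsFractionRing O K]
variable {n : ℕ} {φ : ℕ → K[X]} {lam : ℕ → ℚ} {i : ℕ}

namespace KeyChain

variable [IsAlgClosed (IsLocalRing.ResidueField O)] (h : KeyChain O n φ lam)
include h

lemma le_val_of_le_val_succ (hi : i + 1 < n) {f : K[X]} {M : ℕ}
    (hdeg : f.natDegree ≤ M * (φ (i + 2)).natDegree)
    (hle : ((M * lam (i + 2) : ℚ) : WithTop ℚ) ≤ val O φ lam (i + 2) f) :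
    (((M * ramIdx φ lam (i + 1) : ℕ) * lam (i + 1) : ℚ) : WithTop ℚ) ≤
      val O φ lam (i + 1) f := by
  obtain ⟨V, H, hV, hV', -⟩ := h.exists_augmentable hi
  have hlt : f.natDegree < (M + 1) * (φ (i + 2)).natDegree := by
    linarith [H.natDegree_pos]
  rw [← hV, ← sum_digit H.monic hlt]
  refine V.map_le_sum fun j hj => ?_
  rw [← hV'] at hle
  have hterm := hle.trans (augment_le H.monic H.natDegree_pos f j)
  have hphi : V (φ (i + 2)) = ((ramIdx φ lam (i + 1) * lam (i + 1) : ℚ) : WithTop ℚ) := by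
    rw [hV, h.val_succ (by omega)]
  rw [V.map_mul, V.map_pow, hphi, ← WithTop.coe_nsmul, nsmul_eq_mul, Nat.cast_mul, mul_assoc,
    add_comm (((j : ℕ) * _ : ℚ) : WithTop ℚ)]
  refine coe_mul_le_add_of_le (Nat.lt_succ_iff.1 (Finset.mem_range.1 hj))
    (h.ramIdx_mul_lam_lt hi).le ?_
  rwa [termVal] at hterm

lemma exists_le_val (hi : i < n) :
    ∃ M : ℕ, (φ (n + 1)).natDegree = M * (φ (i + 1)).natDegree ∧
      ((M * lam (i + 1) : ℚ) : WithTop ℚ) ≤ val O φ lam (i + 1) (φ (n + 1)) := by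
  obtain ⟨k, hk⟩ := Nat.exists_eq_add_of_lt hi
  induction k generalizing i with
  | zero =>
    obtain rfl : n = i + 1 := by omega
    exact ⟨ramIdx φ lam (i + 1), h.natDegree_succ hi, (h.val_succ hi).ge⟩
  | succ k ih =>
    have hi1 : i + 1 < n := by omega
    obtain ⟨M, hM, hle⟩ := ih hi1 (by omega)
    refine ⟨M * ramIdx φ lam (i + 1), ?_, h.le_val_of_le_val_succ hi1 hM.le hle⟩
    rw [hM, h.natDegree_succ hi, mul_assoc]

end KeyChain

variable {Ω : Type*} [Field Ω] (w : AddValuation Ω (WithTop ℚ))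

lemma le_map_of_sum_eq_zero {x : Ω} {c : ℕ → Ω} {M : ℕ} {l : ℚ}
    (hsum : ∑ j ∈ Finset.range M, c j * x ^ j + x ^ M = 0)
    (hc : ∀ j < M, (((M - j) * l : ℚ) : WithTop ℚ) ≤ w (c j)) : (l : WithTop ℚ) ≤ w x := by
  by_contra! hlt
  obtain ⟨m, hm⟩ := WithTop.ne_top_iff_exists.1 hlt.ne_top
  rw [← hm, WithTop.coe_lt_coe] at hlt
  have hpow : ∀ j : ℕ, w (x ^ j) = ((j * m : ℚ) : WithTop ℚ) := fun j => by
    rw [w.map_pow, ← hm, ← WithTop.coe_nsmul, nsmul_eq_mul]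
  have hdom : w (x ^ M) < w (∑ j ∈ Finset.range M, c j * x ^ j) := by
    refine w.map_lt_sum (hpow M ▸ WithTop.coe_ne_top) fun j hj => ?_
    have hjM := Finset.mem_range.1 hj
    have hj' : (j : ℚ) < M := by exact_mod_cast hjM
    calc w (x ^ M) = ((M * m : ℚ) : WithTop ℚ) := hpow M
      _ < (((M - j) * l + j * m : ℚ) : WithTop ℚ) := by
        rw [WithTop.coe_lt_coe]
        linarith [mul_lt_mul_of_pos_left hlt (sub_pos.2 hj')]
      _ ≤ w (c j * x ^ j) := by
        rw [w.map_mul, hpow, WithTop.coe_add]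
        exact add_le_add_left (hc j hjM) _
  rw [eq_neg_of_add_eq_zero_left hsum, w.map_neg] at hdom
  exact lt_irrefl _ hdom

variable {w} [Algebra K Ω] {β : Ω}

namespace Augmentable

variable {V : AddValuation K[X] (WithTop ℚ)} {ψ f : K[X]} {l : ℚ}

lemma valuation_le_map_aeval (H : Augmentable V ψ l) (hV : ∀ g : K[X], V g ≤ w (aeval β g))
    (hl : (l : WithTop ℚ) ≤ w (aeval β ψ)) (g : K[X]) : H.valuation g ≤ w (aeval β g) := by
  conv_rhs => rw [← sum_digit H.monic (natDegree_lt_succ_mul H.natDegree_pos g), map_sum]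
  refine w.map_le_sum fun j _ => (augment_le H.monic H.natDegree_pos g j).trans ?_
  rw [termVal, map_mul, map_pow, w.map_mul, w.map_pow, add_comm, ← nsmul_eq_mul,
    WithTop.coe_nsmul]
  exact add_le_add (nsmul_le_nsmul_right hl j) (hV _)

lemma le_map_aeval (H : Augmentable V ψ l) (hV : ∀ g : K[X], V g ≤ w (aeval β g)) (hf : f.Monic)
    {M : ℕ} (hdeg : f.natDegree = M * ψ.natDegree)
    (hle : ((M * l : ℚ) : WithTop ℚ) ≤ H.valuation f) (hβ : aeval β f = 0) :
    (l : WithTop ℚ) ≤ w (aeval β ψ) := by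
  refine le_map_of_sum_eq_zero w (c := fun j => aeval β (digit ψ f j)) (M := M) ?_ fun j _ => ?_
  · have hlt : f.natDegree < (M + 1) * ψ.natDegree := by linarith [H.natDegree_pos]
    rw [← hβ, ← congrArg (aeval β) (sum_digit H.monic hlt), Finset.sum_range_succ,
      digit_of_natDegree_eq H.monic H.natDegree_pos hf hdeg, mul_one, map_add, map_sum, map_pow]
    simp_rw [map_mul, map_pow, mul_comm]
  · refine le_trans ?_ (hV _)
    have hterm := hle.trans (augment_le H.monic H.natDegree_pos f j)
    refine (WithTop.add_le_add_iff_right (z := ((j * l : ℚ) : WithTop ℚ)) WithTop.coe_ne_top).1 ?_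
    rwa [← WithTop.coe_add, ← add_mul, sub_add_cancel]

end Augmentable

variable (hw : ∀ x : K, w (algebraMap K Ω x) = ord O x)
include hw

lemma map_root_nonneg {f : K[X]} (hf : f.Monic) (hint : f ∈ Polynomial.lifts (algebraMap O K))
    (hβ : aeval β f = 0) : 0 ≤ w β := by
  obtain ⟨g, rfl⟩ := (mem_lifts _).1 hint
  refine le_map_of_sum_eq_zero w (c := fun j => algebraMap K Ω ((g.map (algebraMap O K)).coeff j))
    (M := (g.map (algebraMap O K)).natDegree) (l := 0) ?_ fun j _ => ?_
  · rw [aeval_eq_sum_range, Finset.sum_range_succ, coeff_natDegree, hf.leadingCoeff, one_smul] at hβ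
    simpa only [Algebra.smul_def] using hβ
  · rw [hw, mul_zero, coeff_map]
    exact ord_algebraMap_nonneg O _

lemma gauss_le_map_aeval (hβ : 0 ≤ w β) (g : K[X]) : gauss O g ≤ w (aeval β g) := by
  rw [aeval_eq_sum_range, gauss_eq_augment]
  refine w.map_le_sum fun j _ => ?_
  rw [Algebra.smul_def, w.map_mul, w.map_pow, hw, ← termVal_evalVal_X]
  exact (augment_le monic_X (by simp) g j).trans (le_add_of_nonneg_right (nsmul_nonneg hβ j))

namespace KeyChain

variable [IsAlgClosed (IsLocalRing.ResidueField O)]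

lemma val_le_map_aeval (h : KeyChain O n φ lam) (hβ : aeval β (φ (n + 1)) = 0) (hi : i ≤ n)
    (g : K[X]) : val O φ lam i g ≤ w (aeval β g) := by
  induction i generalizing g with
  | zero =>
    have hf := h.key n le_rfl
    exact gauss_le_map_aeval hw (map_root_nonneg hw hf.monic hf.integral hβ) g
  | succ i ih =>
    obtain ⟨V, H, hV, hV', -⟩ := h.exists_augmentable hi
    obtain ⟨M, hM, hle⟩ := h.exists_le_val hi
    have hVw : ∀ g, V g ≤ w (aeval β g) := fun g => hV ▸ ih (by omega) g
    rw [← hV'] at hle ⊢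
    exact H.valuation_le_map_aeval hVw (H.le_map_aeval hVw (h.monic le_rfl) hM hle hβ) g

lemma lam_le_map_aeval (h : KeyChain O n φ lam) (hβ : aeval β (φ (n + 1)) = 0) (hi : i < n) :
    (lam (i + 1) : WithTop ℚ) ≤ w (aeval β (φ (i + 1))) := by
  obtain ⟨V, H, -, hV', -⟩ := h.exists_augmentable hi
  have hphi := H.valuation_pow_mul 1 1
  rw [pow_one, mul_one, AddValuation.map_one, zero_add, Nat.cast_one, one_mul, hV'] at hphi
  exact hphi ▸ h.val_le_map_aeval hw hβ (Nat.succ_le_of_lt hi) _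

end KeyChain

end Root

section ResidueSystem

/-- The numbers `x 0, …, x (d - 1)` represent the classes of `(1 / d) ℤ` modulo `ℤ`, each of them
once. -/
structure IsResidueSystem (d : ℕ) (x : ℕ → ℚ) : Prop where
  exists_int : ∀ m < d, ∃ k : ℤ, d * x m = k
  eq_of_sub_eq : ∀ m < d, ∀ m' < d, ∀ k : ℤ, x m - x m' = k → m = m'

namespace IsResidueSystem

variable {d : ℕ} {x : ℕ → ℚ}

lemma exists_fract_eq (h : IsResidueSystem d x) {m : ℕ} (hm : m < d) :
    ∃ j < d, Int.fract (x m) = (j / d : ℚ) := by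
  have hd : (0 : ℤ) < d := by omega
  obtain ⟨k, hk⟩ := h.exists_int m hm
  have hxm : x m = k / d := by rw [eq_div_iff (by exact_mod_cast hd.ne'), mul_comm, hk]
  have hnonneg := Int.emod_nonneg k hd.ne'
  have hlt := Int.emod_lt_of_pos k hd
  refine ⟨(k % d).toNat, by omega, ?_⟩
  rw [hxm, Int.fract_div_intCast_eq_div_intCast_mod, ← Int.cast_natCast (k % d).toNat,
    Int.toNat_of_nonneg hnonneg]

lemma two_mul_sum_fract (h : IsResidueSystem d x) (hd : 0 < d) :
    2 * ∑ m ∈ Finset.range d, Int.fract (x m) = d - 1 := by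
  choose! j hjd hj using fun m (hm : m < d) => h.exists_fract_eq hm
  have hmaps : Set.MapsTo j (Finset.range d) (Finset.range d) := fun m hm =>
    Finset.mem_coe.2 (Finset.mem_range.2 (hjd m (Finset.mem_range.1 hm)))
  have hinj : Set.InjOn j (Finset.range d) := by
    intro m hm m' hm' heq
    have hmd := Finset.mem_range.1 hm
    have hmd' := Finset.mem_range.1 hm'
    obtain ⟨k, hk⟩ := Int.fract_eq_fract.1 ((hj m hmd).trans (heq ▸ (hj m' hmd').symm))
    exact h.eq_of_sub_eq m hmd m' hmd' k hk
  have hsum : ∑ m ∈ Finset.range d, Int.fract (x m) = ∑ i ∈ Finset.range d, (i / d : ℚ) :=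
    Finset.sum_nbij j hmaps hinj (Finset.surjOn_of_injOn_of_card_le j hmaps hinj le_rfl)
      fun m hm => hj m (Finset.mem_range.1 hm)
  have hgauss : (∑ i ∈ Finset.range d, (i : ℚ)) * 2 = d * (d - 1) := by
    have hnat := congrArg (Nat.cast : ℕ → ℚ) (Finset.sum_range_id_mul_two d)
    rwa [Nat.cast_mul, Nat.cast_sum, Nat.cast_mul, Nat.cast_pred hd] at hnat
  rw [hsum, ← Finset.sum_div, mul_comm, div_mul_eq_mul_div, hgauss,
    mul_div_cancel_left₀ _ (Nat.cast_ne_zero.2 hd.ne')]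

lemma two_mul_sum_floor (h : IsResidueSystem d x) (hd : 0 < d) :
    2 * ∑ m ∈ Finset.range d, (⌊x m⌋ : ℚ) = 2 * ∑ m ∈ Finset.range d, x m - (d - 1) := by
  rw [← h.two_mul_sum_fract hd, ← mul_sub, ← Finset.sum_sub_distrib]
  simp only [Int.self_sub_fract]

lemma mul_div_add_mod (h : IsResidueSystem d x) (hd : 0 < d) (l : ℚ) :
    IsResidueSystem ((d * l).den * d) fun m => (m / d : ℕ) * l + x (m % d) := by
  have hmod : ∀ m, m % d < d := fun m => Nat.mod_lt m hd
  refine ⟨fun m _ => ?_, fun m hm m' hm' k hk => ?_⟩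
  · obtain ⟨k, hk⟩ := h.exists_int _ (hmod m)
    generalize m / d = q
    refine ⟨q * (d * l).num + (d * l).den * k, ?_⟩
    push_cast [← hk, ← Rat.mul_den_eq_num]
    ring
  · obtain ⟨a, ha⟩ := h.exists_int _ (hmod m)
    obtain ⟨b, hb⟩ := h.exists_int _ (hmod m')
    have hdiv : m / d = m' / d := by
      have hlt := Nat.div_lt_of_lt_mul (mul_comm (d * l).den d ▸ hm)
      have hlt' := Nat.div_lt_of_lt_mul (mul_comm (d * l).den d ▸ hm')
      generalize m / d = q at *
      generalize m' / d = q' at *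
      have hmul : ((q - q' : ℤ) : ℚ) * (d * l) = ((d * k - a + b : ℤ) : ℚ) := by
        push_cast [← ha, ← hb, ← hk]
        ring
      have habs : |(q - q' : ℤ)| < (d * l).den := by
        rw [abs_lt]
        constructor <;> omega
      have hzero := Int.eq_zero_of_abs_lt_dvd (den_dvd_of_mul_eq_intCast hmul) habs
      exact_mod_cast sub_eq_zero.1 hzero
    have hsub : x (m % d) - x (m' % d) = k := by
      rw [← hk, hdiv, add_sub_add_left_eq_sub]
    rw [← Nat.div_add_mod m d, ← Nat.div_add_mod m' d, hdiv,
      h.eq_of_sub_eq _ (hmod m) _ (hmod m') k hsub]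

end IsResidueSystem

lemma sum_range_mul_div_add_mod {d : ℕ} (hd : 0 < d) (r : ℕ) (l : ℚ) (x : ℕ → ℚ) :
    2 * ∑ m ∈ Finset.range (r * d), ((m / d : ℕ) * l + x (m % d)) =
      r * (2 * ∑ m ∈ Finset.range d, x m) + d * l * r * (r - 1) := by
  induction r with
  | zero => simp
  | succ r ih =>
    have hblock : ∀ m ∈ Finset.range d,
        (((r * d + m) / d : ℕ) * l + x ((r * d + m) % d)) = r * l + x m := by
      intro m hm
      have hmd := Finset.mem_range.1 hm
      rw [mul_comm r d, Nat.mul_add_div hd, Nat.div_eq_of_lt hmd, add_zero, Nat.mul_add_mod,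
        Nat.mod_eq_of_lt hmd]
    rw [Nat.succ_mul, Finset.sum_range_add, mul_add, ih, Finset.sum_congr rfl hblock,
      Finset.sum_add_distrib, Finset.sum_const, Finset.card_range, nsmul_eq_mul, Nat.cast_succ]
    ring

end ResidueSystem

section ChainBasis

variable {K : Type*} [Field K]

/-- The product `φ 1 ^ a₁ * ⋯ * φ i ^ aᵢ` of degree `m`, where the exponents are the digits of `m`
in the mixed radix system with places `deg (φ 1) ∣ deg (φ 2) ∣ ⋯`. -/
noncomputable def basisPoly (φ : ℕ → K[X]) : ℕ → ℕ → K[X]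
  | 0, _ => 1
  | i + 1, m => φ (i + 1) ^ (m / (φ (i + 1)).natDegree) *
      basisPoly φ i (m % (φ (i + 1)).natDegree)

/-- The Mac Lane valuation `a₁ * lam 1 + ⋯ + aᵢ * lam i` of the product `basisPoly φ i m`. -/
def basisVal (φ : ℕ → K[X]) (lam : ℕ → ℚ) : ℕ → ℕ → ℚ
  | 0, _ => 0
  | i + 1, m => (m / (φ (i + 1)).natDegree : ℕ) * lam (i + 1) +
      basisVal φ lam i (m % (φ (i + 1)).natDegree)

/-- The contribution of the first `i` augmentations to the discriminant bonus: twice the exponent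
of the index of the order generated by a root of `φ (i + 1)` in the lattice spanned by the
products `basisPoly φ i m`, divided by powers of the uniformizer so as to be integral. -/
def chainBonus (φ : ℕ → K[X]) (lam : ℕ → ℚ) : ℕ → ℚ
  | 0 => 0
  | i + 1 => ramIdx φ lam (i + 1) * chainBonus φ lam i +
    (ramIdx φ lam (i + 1) - 1) *
      (ramIdx φ lam (i + 1) * ((φ (i + 1)).natDegree * lam (i + 1)) - 1)

variable {O : Type*} [CommRing O] [IsDomain O] [IsDiscreteValuationRing O]
variable [Algebra O K] [IsFractionRing O K] [IsAlgClosed (IsLocalRing.ResidueField O)]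
variable {n : ℕ} {φ : ℕ → K[X]} {lam : ℕ → ℚ} {i : ℕ}

namespace KeyChain

variable (h : KeyChain O n φ lam)
include h

omit [IsAlgClosed (IsLocalRing.ResidueField O)] in
lemma monic_basisPoly (hi : i ≤ n) (m : ℕ) : (basisPoly φ i m).Monic := by
  induction i generalizing m with
  | zero => exact monic_one
  | succ i ih => exact ((h.monic (by omega)).pow _).mul (ih (by omega) _)

lemma natDegree_basisPoly (hi : i ≤ n) {m : ℕ} (hm : m < (φ (i + 1)).natDegree) :
    (basisPoly φ i m).natDegree = m := by
  induction i generalizing m with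
  | zero =>
    rw [h.natDegree_one, Nat.lt_one_iff] at hm
    rw [basisPoly, Polynomial.natDegree_one, hm]
  | succ i ih =>
    rw [basisPoly, ((h.monic (by omega)).pow _).natDegree_mul (h.monic_basisPoly (by omega) _),
      natDegree_pow, ih (by omega) (Nat.mod_lt _ (h.natDegree_pos (by omega))), mul_comm,
      Nat.div_add_mod]

lemma isResidueSystem_basisVal (hi : i ≤ n) :
    IsResidueSystem (φ (i + 1)).natDegree (basisVal φ lam i) := by
  induction i with
  | zero =>
    rw [h.natDegree_one]
    exact ⟨fun m _ => ⟨0, by simp [basisVal]⟩, fun m hm m' hm' _ _ => by omega⟩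
  | succ i ih =>
    rw [h.natDegree_succ hi]
    exact (ih (by omega)).mul_div_add_mod (h.natDegree_pos (by omega)) (lam (i + 1))

lemma two_mul_sum_basisVal (hi : i ≤ n) :
    2 * ∑ m ∈ Finset.range (φ (i + 1)).natDegree, basisVal φ lam i m =
      chainBonus φ lam i + ((φ (i + 1)).natDegree - 1) := by
  induction i with
  | zero => simp [h.natDegree_one, basisVal, chainBonus]
  | succ i ih =>
    simp only [h.natDegree_succ hi, basisVal]
    rw [sum_range_mul_div_add_mod (h.natDegree_pos (by omega)), ih (by omega), chainBonus,
      Nat.cast_mul]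
    ring

lemma two_mul_sum_floor_basisVal :
    2 * ∑ m ∈ Finset.range (φ (n + 1)).natDegree, (⌊basisVal φ lam n m⌋ : ℚ) =
      chainBonus φ lam n := by
  rw [(h.isResidueSystem_basisVal le_rfl).two_mul_sum_floor (h.natDegree_pos le_rfl),
    h.two_mul_sum_basisVal le_rfl, add_sub_cancel_right]

lemma basisVal_le_map_aeval {Ω : Type*} [Field Ω] [Algebra K Ω]
    {w : AddValuation Ω (WithTop ℚ)} (hw : ∀ x : K, w (algebraMap K Ω x) = ord O x) {β : Ω}
    (hβ : aeval β (φ (n + 1)) = 0) (hi : i ≤ n) (m : ℕ) :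
    (basisVal φ lam i m : WithTop ℚ) ≤ w (aeval β (basisPoly φ i m)) := by
  induction i generalizing m with
  | zero => simp [basisVal, basisPoly]
  | succ i ih =>
    rw [basisPoly, basisVal, map_mul, map_pow, w.map_mul, w.map_pow, WithTop.coe_add,
      ← nsmul_eq_mul, WithTop.coe_nsmul]
    exact add_le_add (nsmul_le_nsmul_right (h.lam_le_map_aeval hw hβ hi) _) (ih (by omega) _)

end KeyChain

end ChainBasis

section PowerBasis

variable {K L : Type*} [Field K] [Field L] [Algebra K L]

lemma repr_aeval_gen (pb : PowerBasis K L) {g : K[X]} (hg : g.natDegree < pb.dim)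
    (j : Fin pb.dim) : pb.basis.repr (aeval pb.gen g) j = g.coeff j := by
  have hsum : aeval pb.gen g = ∑ i : Fin pb.dim, g.coeff i • pb.basis i := by
    rw [aeval_eq_sum_range' hg, ← Fin.sum_univ_eq_sum_range fun i => g.coeff i • pb.gen ^ i]
    simp only [pb.basis_eq_pow]
  rw [hsum, pb.basis.repr_sum_self]

variable [Algebra.IsSeparable K L]

lemma norm_aeval_gen_eq_resultant (pb : PowerBasis K L) (g : K[X]) {n : ℕ}
    (hg : g.natDegree ≤ n) :
    Algebra.norm K (aeval pb.gen g) =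
      resultant (minpoly K pb.gen) g (minpoly K pb.gen).natDegree n := by
  classical
  have := pb.finite
  let E := AlgebraicClosure L
  have hconj : ∏ σ : L →ₐ[K] E, σ (aeval pb.gen g) =
      (((minpoly K pb.gen).aroots E).map fun x => aeval x g).prod := by
    rw [Fintype.prod_equiv pb.liftEquiv' _ (fun x => aeval (x : E) g) fun σ => by
        rw [PowerBasis.liftEquiv'_apply_coe, aeval_algHom_apply],
      Finset.prod_mem_multiset _ _ (fun x => aeval x g) fun _ => rfl,
      Finset.prod_eq_multiset_prod, Multiset.toFinset_val, Multiset.dedup_eq_self.mpr]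
    exact nodup_roots (Separable.map (Algebra.IsSeparable.isSeparable K pb.gen))
  apply (algebraMap K E).injective
  have hmonic := minpoly.monic pb.isIntegral_gen
  rw [Algebra.norm_eq_prod_embeddings, hconj, ← resultant_map_map,
    ← natDegree_map (algebraMap K E),
    resultant_eq_prod_eval _ _ _ (natDegree_map_le.trans hg) (IsAlgClosed.splits _),
    (hmonic.map _).leadingCoeff, one_pow, one_mul]
  simp only [eval_map_algebraMap, aroots_def]

lemma discr_powerBasis_eq_discr_minpoly (pb : PowerBasis K L) :
    Algebra.discr K pb.basis = (minpoly K pb.gen).discr := by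
  have := pb.finite
  rw [Algebra.discr_powerBasis_eq_norm, norm_aeval_gen_eq_resultant pb _
    (natDegree_derivative_le _), resultant_deriv (minpoly.degree_pos pb.isIntegral_gen),
    (minpoly.monic pb.isIntegral_gen).leadingCoeff, mul_one, ← mul_assoc, pb.finrank,
    pb.natDegree_minpoly, ← mul_pow, neg_one_mul, neg_neg, one_pow, one_mul]

lemma discr_smul_aeval_gen (pb : PowerBasis K L) {G : ℕ → K[X]}
    (hG : ∀ m < pb.dim, (G m).Monic) (hd : ∀ m < pb.dim, (G m).natDegree = m) (c : ℕ → K) :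
    Algebra.discr K (fun m : Fin pb.dim => c m • aeval pb.gen (G m)) =
      (∏ m ∈ Finset.range pb.dim, c m) ^ 2 * (minpoly K pb.gen).discr := by
  let b : Fin pb.dim → L := fun m => c m • aeval pb.gen (G m)
  have hentry (i j : Fin pb.dim) : pb.basis.toMatrix b i j = c j * (G j).coeff i := by
    rw [Module.Basis.toMatrix_apply, map_smul, Finsupp.smul_apply, smul_eq_mul,
      repr_aeval_gen pb (by rw [hd j j.2]; exact j.2)]
  have htri : (pb.basis.toMatrix b).IsUpperTriangular := by
    intro i j hij
    rw [hentry, coeff_eq_zero_of_natDegree_lt (by rw [hd j j.2]; exact hij), mul_zero]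
  have hdiag (i : Fin pb.dim) : pb.basis.toMatrix b i i = c i := by
    have hlead := (hG i i.2).coeff_natDegree
    rw [hd i i.2] at hlead
    rw [hentry, hlead, mul_one]
  change Algebra.discr K b = _
  rw [← Module.Basis.toMatrix_map_vecMul pb.basis b, Algebra.discr_of_matrix_vecMul,
    discr_powerBasis_eq_discr_minpoly, Matrix.det_of_isUpperTriangular htri,
    ← Fin.prod_univ_eq_prod_range]
  simp only [hdiag]

end PowerBasis

section Integrality

variable {Ω : Type*} [Field Ω]

lemma coeff_prod_X_sub_C_nonneg (w : AddValuation Ω (WithTop ℚ)) (s : Multiset Ω)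
    (hs : ∀ y ∈ s, 0 ≤ w y) (i : ℕ) : 0 ≤ w ((s.map fun y => X - C y).prod.coeff i) := by
  induction s using Multiset.induction_on generalizing i with
  | empty =>
    rw [Multiset.map_zero, Multiset.prod_zero, coeff_one]
    split_ifs <;> simp
  | cons a s ih =>
    rw [Multiset.forall_mem_cons] at hs
    rw [Multiset.map_cons, Multiset.prod_cons, sub_mul, coeff_sub, coeff_C_mul]
    refine w.map_le_sub ?_ (w.map_mul _ _ ▸ add_nonneg hs.1 (ih hs.2 i))
    cases i with
    | zero => simp
    | succ i => simpa only [coeff_X_mul] using ih hs.2 i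

variable {O : Type*} [CommRing O] [IsDomain O] [IsDiscreteValuationRing O]
variable {K : Type*} [Field K] [Algebra O K] [IsFractionRing O K]
variable [Algebra K Ω] [Normal K Ω] [Algebra O Ω] [IsScalarTower O K Ω]
variable {w : AddValuation Ω (WithTop ℚ)} (hw : ∀ x : K, w (algebraMap K Ω x) = ord O x)
include hw

lemma isIntegral_of_forall_root_nonneg {x : Ω} (hx : ∀ y, aeval y (minpoly K x) = 0 → 0 ≤ w y) :
    IsIntegral O x := by
  have hmonic := minpoly.monic (Normal.isIntegral inferInstance x : IsIntegral K x)
  have hroots : ∀ y ∈ ((minpoly K x).map (algebraMap K Ω)).roots, 0 ≤ w y := fun y hy =>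
    hx y (eval_map_algebraMap (minpoly K x) y ▸ (mem_roots'.1 hy).2)
  have hlift : minpoly K x ∈ lifts (algebraMap O K) := by
    rw [lifts_iff_coeff_lifts]
    intro i
    rw [Set.mem_range, ← ord_nonneg_iff, ← hw, ← coeff_map,
      (Normal.splits inferInstance x).eq_prod_roots_of_monic (hmonic.map _)]
    exact coeff_prod_X_sub_C_nonneg w _ hroots i
  obtain ⟨q, hq, -, hqm⟩ := lifts_and_natDegree_eq_and_monic hlift hmonic
  refine ⟨q, hqm, ?_⟩
  rw [← aeval_def, ← aeval_map_algebraMap K, hq, minpoly.aeval]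

lemma isIntegral_aeval {α : Ω} {g : K[X]}
    (hg : ∀ β : Ω, aeval β (minpoly K α) = 0 → 0 ≤ w (aeval β g)) :
    IsIntegral O (aeval α g) := by
  refine isIntegral_of_forall_root_nonneg hw fun y hy => ?_
  obtain ⟨σ, hσ⟩ := minpoly.exists_algEquiv_of_root'
    (Normal.isIntegral inferInstance (aeval α g)).isAlgebraic hy
  have hσg (h : K[X]) : aeval (σ α) h = σ (aeval α h) := aeval_algHom_apply (σ : Ω →ₐ[K] Ω) α h
  rw [← hσ, ← hσg]
  exact hg _ (by rw [hσg, minpoly.aeval, map_zero])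

lemma isIntegral_smul_aeval_gen {α : Ω} {c : K} {g : K[X]}
    (h : ∀ β : Ω, aeval β (minpoly K α) = 0 → 0 ≤ ord O c + w (aeval β g)) :
    IsIntegral O (c • aeval (AdjoinSimple.gen K α) g) := by
  have hinj : Function.Injective ((K⟮α⟯.val).restrictScalars O) := K⟮α⟯.val.injective
  have hval : ((K⟮α⟯.val).restrictScalars O) (c • aeval (AdjoinSimple.gen K α) g) =
      aeval α (C c * g) := by
    rw [map_mul, aeval_C, ← Algebra.smul_def, AlgHom.restrictScalars_apply, map_smul,
      ← aeval_algHom_apply, coe_val, AdjoinSimple.coe_gen]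
  rw [← isIntegral_algHom_iff _ hinj, hval]
  refine isIntegral_aeval hw fun β hβ => ?_
  rw [map_mul, aeval_C, w.map_mul, hw]
  exact h β hβ

end Integrality

section Discriminant

lemma discr_comp_equiv {A B ι ι' : Type*} [CommRing A] [CommRing B] [Algebra A B] [Fintype ι]
    [Fintype ι'] [DecidableEq ι] [DecidableEq ι'] (b : ι → B) (e : ι' ≃ ι) :
    Algebra.discr A (b ∘ e) = Algebra.discr A b := by
  rw [Algebra.discr_def, Algebra.discr_def]
  exact Matrix.det_submatrix_equiv_self e (Algebra.traceMatrix A b)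

variable (O : Type*) [CommRing O] [IsDomain O] [IsDiscreteValuationRing O]
variable (K : Type*) [Field K] [Algebra O K] [IsFractionRing O K]

lemma exists_discr_eq_sq_mul_fieldDiscr {L : Type*} [Field L] [Algebra K L] [Algebra O L]
    [IsScalarTower O K L] [FiniteDimensional K L] [Algebra.IsSeparable K L] {ι : Type*}
    [Fintype ι] [DecidableEq ι] (hι : Fintype.card ι = Module.finrank K L) {b : ι → L}
    (hb : ∀ i, IsIntegral O (b i)) :
    ∃ a : O, Algebra.discr K b = algebraMap O K a ^ 2 * fieldDiscr O K L := by
  classical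
  have : Module.Finite O (integralClosure O L) :=
    IsIntegralClosure.finite O K L (integralClosure O L)
  have : Module.IsTorsionFree O K := inferInstance
  have : Module.IsTorsionFree O L := Module.IsTorsionFree.trans_faithfulSMul O K L
  have : Module.Free O (integralClosure O L) :=
    IsIntegralClosure.module_free O K L (integralClosure O L)
  let B := Module.Free.chooseBasis O (integralClosure O L)
  let e : Module.Free.ChooseBasisIndex O (integralClosure O L) ≃ ι := Fintype.equivOfCardEq <| by
    rw [← Module.finrank_eq_card_chooseBasisIndex, IsIntegralClosure.rank O K L, hι]
  let b' : Module.Free.ChooseBasisIndex O (integralClosure O L) → integralClosure O L :=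
    fun i => ⟨b (e i), hb (e i)⟩
  let P := B.toMatrix b'
  have hP : Matrix.vecMul (fun i => ((B i : integralClosure O L) : L))
      ((P.map (algebraMap O K)).map (algebraMap K L)) = b ∘ e := by
    funext i
    have hi := congrArg Subtype.val (congrFun (Module.Basis.toMatrix_map_vecMul B b') i)
    simp only [Matrix.vecMul, dotProduct, Matrix.map_apply] at hi ⊢
    simpa [P, b', ← IsScalarTower.algebraMap_apply] using hi
  refine ⟨P.det, ?_⟩
  rw [← discr_comp_equiv b e, ← hP, Algebra.discr_of_matrix_vecMul, ← RingHom.mapMatrix_apply,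
    ← RingHom.map_det, fieldDiscr]

variable {O K}

lemma neg_two_mul_ordInt_le {c x y : K} {a : O} (hc : c ≠ 0) (hx : x ≠ 0)
    (h : c ^ 2 * x = algebraMap O K a ^ 2 * y) :
    -(2 * ordInt O c) ≤ ordInt O x - ordInt O y := by
  have hcx : algebraMap O K a ^ 2 * y ≠ 0 := h ▸ mul_ne_zero (pow_ne_zero 2 hc) hx
  have ha : algebraMap O K a ≠ 0 := fun ha => hcx (by rw [ha, zero_pow two_ne_zero, zero_mul])
  have hord := congrArg (ordInt O) h
  rw [ordInt_mul O (pow_ne_zero 2 hc) hx, ordInt_mul O (pow_ne_zero 2 ha)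
    (right_ne_zero_of_mul hcx), ordInt_pow, ordInt_pow] at hord
  have hnonneg : 0 ≤ ordInt O (algebraMap O K a) := by
    have hle := ord_algebraMap_nonneg O (K := K) a
    rw [ord_of_ne_zero O ha] at hle
    exact_mod_cast hle
  push_cast at hord
  linarith

variable {Ω : Type*} [Field Ω] [Algebra K Ω] [Algebra.IsSeparable K Ω] [Normal K Ω]
variable [Algebra O Ω] [IsScalarTower O K Ω]

lemma two_mul_sum_le_discBonus {w : AddValuation Ω (WithTop ℚ)}
    (hw : ∀ x : K, w (algebraMap K Ω x) = ord O x) (α : Ω) {G : ℕ → K[X]} {k : ℕ → ℤ}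
    (hG : ∀ m < (minpoly K α).natDegree, (G m).Monic)
    (hd : ∀ m < (minpoly K α).natDegree, (G m).natDegree = m)
    (hk : ∀ m < (minpoly K α).natDegree, ∀ β : Ω, aeval β (minpoly K α) = 0 →
      ((k m : ℚ) : WithTop ℚ) ≤ w (aeval β (G m))) :
    2 * ∑ m ∈ Finset.range (minpoly K α).natDegree, k m ≤ discBonus O K α := by
  have hα : IsIntegral K α := Algebra.IsSeparable.isIntegral K α
  have : FiniteDimensional K K⟮α⟯ := adjoin.finiteDimensional hα
  let pb : PowerBasis K K⟮α⟯ := adjoin.powerBasis hα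
  have hgen : minpoly K pb.gen = minpoly K α := minpoly_gen K α
  have hdim : pb.dim = (minpoly K α).natDegree := adjoin.powerBasis_dim hα
  rw [← hdim] at hG hd hk ⊢
  choose! c hc0 hc using fun m => exists_ordInt_eq O K (-k m)
  have hint (i : Fin pb.dim) : IsIntegral O (c i • aeval pb.gen (G i)) := by
    refine isIntegral_smul_aeval_gen hw fun β hβ => ?_
    refine le_trans (le_of_eq ?_) (add_le_add_right (hk i i.2 β hβ) _)
    rw [ord_of_ne_zero O (hc0 i), hc, ← WithTop.coe_add, Int.cast_neg, neg_add_cancel,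
      WithTop.coe_zero]
  obtain ⟨a, ha⟩ := exists_discr_eq_sq_mul_fieldDiscr O K
    ((Fintype.card_fin _).trans pb.finrank.symm) hint
  rw [discr_smul_aeval_gen pb hG hd, hgen] at ha
  have hdiscr : (minpoly K α).discr ≠ 0 := by
    rw [← hgen, ← discr_powerBasis_eq_discr_minpoly]
    exact Algebra.discr_not_zero_of_basis K pb.basis
  have hle := neg_two_mul_ordInt_le (Finset.prod_ne_zero_iff.2 fun m _ => hc0 m) hdiscr ha
  simp only [ordInt_prod O _ _ fun m _ => hc0 m, hc, Finset.sum_neg_distrib, mul_neg,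
    neg_neg] at hle
  exact hle

end Discriminant

section Eisenstein

lemma isEisensteinAt_of_eval {R : Type*} [CommRing R] {I : Ideal R} (hI : I ≠ ⊤) {g : R[X]}
    (hg : g.Monic) (hdeg : 2 ≤ g.natDegree) (hcoeff : ∀ i < g.natDegree, g.coeff i ∈ I) {c : R}
    (hc : c ∈ I) (heval : g.eval c ∉ I ^ 2) : g.IsEisensteinAt I := by
  refine hg.isEisensteinAt_of_mem_of_notMem hI (hcoeff _) fun hzero => heval ?_
  rw [eval_eq_sum_range]
  refine Ideal.sum_mem _ fun i _ => ?_
  rcases i with _ | _ | i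
  · rwa [pow_zero, mul_one]
  · rw [zero_add, pow_one, pow_two]
    exact Ideal.mul_mem_mul (hcoeff 1 hdeg) hc
  · exact Ideal.mul_mem_left _ _ (Ideal.pow_le_pow_right (by omega) (Ideal.pow_mem_pow hc (i + 2)))

variable {O : Type*} [CommRing O] [IsDomain O] [IsDiscreteValuationRing O]
variable {K : Type*} [Field K] [Algebra O K] [IsFractionRing O K]

lemma natCast_le_ord_of_mem_pow {a : O} {k : ℕ} (ha : a ∈ IsLocalRing.maximalIdeal O ^ k) :
    ((k : ℚ) : WithTop ℚ) ≤ ord O (algebraMap O K a) := by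
  rcases eq_or_ne (algebraMap O K a) 0 with h | h
  · rw [h, ord_zero]
    exact le_top
  · have hle := ((IsDiscreteValuationRing.maximalIdeal O).intValuation_le_pow_iff_mem a k).2 ha
    rw [← IsDedekindDomain.HeightOneSpectrum.valuation_of_algebraMap (K := K),
      ← WithZero.log_le_iff_le_exp (adicValuation_ne_zero O h)] at hle
    rw [ord_of_ne_zero O h, ordInt, WithTop.coe_le_coe]
    exact_mod_cast le_neg_of_le_neg hle

lemma gauss_le_ord_coeff (f : K[X]) (i : ℕ) : gauss O f ≤ ord O (f.coeff i) := by
  by_cases h : f.coeff i = 0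
  · rw [h, ord_zero]
    exact le_top
  · exact Finset.inf_le (mem_support_iff.2 h)

lemma isEisenstein_of_ord_eval {f : K[X]} (hf : f.Monic) (hint : f ∈ lifts (algebraMap O K))
    (hdeg : 2 ≤ f.natDegree) (hX : 0 < gauss O (f - X ^ f.natDegree)) {c : K}
    (hc : 0 < ord O c) (heval : ord O (f.eval c) = 1) : IsEisenstein O f := by
  obtain ⟨g, hg, hgd, hgm⟩ := lifts_and_natDegree_eq_and_monic hint hf
  obtain ⟨c₀, rfl⟩ := (ord_nonneg_iff O).1 hc.le
  rw [ord_algebraMap_pos_iff] at hc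
  refine ⟨g, hg, hgm, isEisensteinAt_of_eval (IsLocalRing.maximalIdeal.isMaximal O).ne_top hgm
    (hgd ▸ hdeg) (fun i hi => ?_) hc fun hmem => ?_⟩
  · rw [← ord_algebraMap_pos_iff O (K := K), ← coeff_map, hg]
    have hlt := hX.trans_le (gauss_le_ord_coeff (O := O) _ i)
    rwa [coeff_sub, coeff_X_pow, if_neg (hgd ▸ hi.ne), sub_zero] at hlt
  · have htwo := natCast_le_ord_of_mem_pow (K := K) hmem
    rw [← eval₂_at_apply, ← eval_map, hg, heval, ← WithTop.coe_one, WithTop.coe_le_coe] at htwo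
    norm_num at htwo

lemma gauss_X_sub_C_pow_sub_X_pow_pos {c : K} (hc : 0 < ord O c) (r : ℕ) :
    0 < gauss O ((X - C c) ^ r - X ^ r) := by
  obtain ⟨c₀, rfl⟩ := (ord_nonneg_iff O).1 hc.le
  obtain ⟨q, hq⟩ := sub_dvd_pow_sub_pow (X - C c₀) X r
  have hmap : (X - C (algebraMap O K c₀)) ^ r - X ^ r =
      -(C (algebraMap O K c₀) * q.map (algebraMap O K)) := by
    rw [sub_sub_cancel_left, neg_mul] at hq
    simpa using congrArg (Polynomial.map (algebraMap O K)) hq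
  have hgauss (f : K[X]) : gauss O f = (augmentable_X O).valuation f :=
    congrFun (gauss_eq_augment O) f
  have hq0 : 0 ≤ gauss O (q.map (algebraMap O K)) := gauss_nonneg ((mem_lifts _).2 ⟨q, rfl⟩)
  rw [hmap, hgauss, AddValuation.map_neg, AddValuation.map_mul, Augmentable.valuation_C,
    evalVal_C, ← hgauss]
  exact hc.trans_le (le_add_of_nonneg_right hq0)

lemma Augmentable.map_sub_pow_pos {V : AddValuation K[X] (WithTop ℚ)} {φ f : K[X]} {lam : ℚ}
    (H : Augmentable V φ lam) (hlam : 0 < lam) (hφ : 0 ≤ V φ) (hf : f.Monic) {r : ℕ}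
    (hr : f.natDegree = r * φ.natDegree)
    (hle : ((r * lam : ℚ) : WithTop ℚ) ≤ H.valuation f) : 0 < V (f - φ ^ r) := by
  have hsum : f - φ ^ r = ∑ j ∈ Finset.range r, φ ^ j * digit φ f j := by
    have hlt : f.natDegree < (r + 1) * φ.natDegree := by linarith [H.natDegree_pos]
    conv_lhs => rw [← sum_digit H.monic hlt]
    rw [Finset.sum_range_succ, digit_of_natDegree_eq H.monic H.natDegree_pos hf hr, mul_one,
      add_sub_cancel_right]
  rw [hsum]
  refine V.map_lt_sum WithTop.zero_ne_top fun j hj => ?_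
  have hdigit : 0 < V (digit φ f j) := by
    have hterm := hle.trans (augment_le H.monic H.natDegree_pos f j)
    by_contra! hnonpos
    have hrj := hterm.trans (add_le_add_left hnonpos _)
    rw [zero_add, WithTop.coe_le_coe, mul_le_mul_iff_left₀ hlam, Nat.cast_le] at hrj
    exact hrj.not_gt (Finset.mem_range.1 hj)
  rw [V.map_mul, V.map_pow]
  exact hdigit.trans_le (le_add_of_nonneg_left (nsmul_nonneg hφ j))

namespace KeyChain

variable [IsAlgClosed (IsLocalRing.ResidueField O)] {n : ℕ} {φ : ℕ → K[X]} {lam : ℕ → ℚ}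
variable {Ω : Type*} [Field Ω] [Algebra K Ω] {w : AddValuation Ω (WithTop ℚ)} {α : Ω}
variable (h : KeyChain O n φ lam) (hw : ∀ x : K, w (algebraMap K Ω x) = ord O x)
variable (hα : aeval α (φ (n + 1)) = 0) (hpos : 0 < w α) (hn : 0 < n)
include h hw hα hpos hn

lemma exists_eq_X_sub_C : ∃ c : K, φ 1 = X - C c ∧ 0 < ord O c := by
  obtain ⟨c, hc⟩ : ∃ c : K, φ 1 = X - C c := ⟨-(φ 1).coeff 0, by
    rw [C_neg, sub_neg_eq_add, ← (h.monic n.zero_le).eq_X_add_C h.natDegree_one]⟩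
  have hroot : 0 < w (aeval α (φ 1)) :=
    (WithTop.coe_lt_coe.2 (h.lam_pos hn)).trans_le (h.lam_le_map_aeval hw hα hn)
  have hsub : algebraMap K Ω c = α - aeval α (φ 1) := by
    rw [hc, map_sub, aeval_X, aeval_C, sub_sub_cancel]
  refine ⟨c, hc, ?_⟩
  rw [← hw, hsub]
  exact (lt_min hpos hroot).trans_le (w.map_sub _ _)

lemma isEisenstein_two (hlam : ramIdx φ lam 1 * lam 1 = 1) : IsEisenstein O (φ 2) := by
  obtain ⟨c, hφ, hc⟩ := h.exists_eq_X_sub_C hw hα hpos hn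
  obtain ⟨V, H, hV, hV', S⟩ := h.exists_augmentable hn
  have hkey := h.key 1 hn
  have hdeg : (φ 2).natDegree = ramIdx φ lam 1 := by
    rw [h.natDegree_succ hn, h.natDegree_one, mul_one]
  have hpow : 0 < V (φ 2 - φ 1 ^ ramIdx φ lam 1) := by
    refine H.map_sub_pow_pos (h.lam_pos hn) ?_ hkey.monic (h.natDegree_succ hn) ?_
    · rw [hV]
      exact gauss_nonneg (h.key 0 n.zero_le).integral
    · rw [hV', h.val_succ hn]
  have hX : 0 < V (φ 2 - X ^ (φ 2).natDegree) := by
    rw [hdeg, ← sub_add_sub_cancel]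
    refine V.map_lt_add hpow ?_
    rw [hV, hφ]
    exact gauss_X_sub_C_pow_sub_X_pow_pos hc _
  have heval : ord O ((φ 2).eval c) = 1 := by
    rw [← S.map_C, hV, ← modByMonic_X_sub_C_eq_C_eval, ← hφ, h.val_mod hn, zero_add, hlam,
      WithTop.coe_one]
  rw [hV] at hX
  exact isEisenstein_of_ord_eval hkey.monic hkey.integral (hdeg ▸ h.two_le_ramIdx hn) hX hc heval

end KeyChain

end Eisenstein

section Bound

lemma bonusBound_lt_of_three_le {r : ℕ} (hr : 3 ≤ r) {x : ℚ} (hx : 2 < x) :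
    bonusBound r x < (r - 1) * (r * x - 1) := by
  have hr' : (3 : ℚ) ≤ r := by exact_mod_cast hr
  have hprod : 0 ≤ ((r : ℚ) - 3) * (x - 2) := mul_nonneg (sub_nonneg.2 hr') (sub_nonneg.2 hx.le)
  rw [bonusBound, if_neg (by linarith)]
  calc 2 * ((⌊x⌋ : ℚ) + r - 1) ≤ 2 * (x + r - 1) := by linarith [Int.floor_le x]
    _ < 2 * (r * x - 1) := by linarith
    _ ≤ (r - 1) * (r * x - 1) := mul_le_mul_of_nonneg_right (by linarith) (by linarith)

variable {K : Type*} [Field K] {n : ℕ} {φ : ℕ → K[X]} {lam : ℕ → ℚ} {i : ℕ}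

lemma chainBonus_succ_of_ramIdx_eq_two (hr : ramIdx φ lam (i + 1) = 2) :
    chainBonus φ lam (i + 1) =
      2 * chainBonus φ lam i + bonusBound 2 ((φ (i + 1)).natDegree * lam (i + 1)) := by
  rw [chainBonus, hr, bonusBound, if_pos rfl]
  push_cast
  ring

variable {O : Type*} [CommRing O] [IsDomain O] [IsDiscreteValuationRing O]
variable [Algebra O K] [IsFractionRing O K] [IsAlgClosed (IsLocalRing.ResidueField O)]

namespace KeyChain

variable (h : KeyChain O n φ lam)
include h

lemma chainBonus_le_discBonus {Ω : Type*} [Field Ω] [Algebra K Ω] [Algebra.IsSeparable K Ω]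
    [Normal K Ω] [Algebra O Ω] [IsScalarTower O K Ω] {w : AddValuation Ω (WithTop ℚ)}
    (hw : ∀ x : K, w (algebraMap K Ω x) = ord O x) {α : Ω} (hα : φ (n + 1) = minpoly K α) :
    chainBonus φ lam n ≤ discBonus O K α := by
  rw [← h.two_mul_sum_floor_basisVal, hα]
  have hle := two_mul_sum_le_discBonus hw α (G := basisPoly φ n)
    (k := fun m => ⌊basisVal φ lam n m⌋) (fun m _ => h.monic_basisPoly le_rfl m)
    (fun m hm => h.natDegree_basisPoly le_rfl (hα ▸ hm)) fun m _ β hβ =>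
      (WithTop.coe_le_coe.2 (Int.floor_le _)).trans
        (h.basisVal_le_map_aeval hw (hα ▸ hβ) le_rfl m)
  exact_mod_cast hle

lemma one_le_ramIdx_mul (hi : i < n) :
    1 ≤ ramIdx φ lam (i + 1) * ((φ (i + 1)).natDegree * lam (i + 1)) := by
  have hd : (0 : ℚ) < (φ (i + 1)).natDegree := Nat.cast_pos.2 (h.natDegree_pos hi.le)
  rw [ramIdx, mul_comm, Rat.mul_den_eq_num]
  exact_mod_cast Rat.num_pos.2 (mul_pos hd (h.lam_pos hi))

lemma one_lt_lam (hi : i + 1 < n) : 1 < lam (i + 2) := by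
  refine lt_of_le_of_lt ?_ (h.ramIdx_mul_lam_lt hi)
  induction i with
  | zero => simpa [h.natDegree_one] using h.one_le_ramIdx_mul (i := 0) (by omega)
  | succ i ih =>
    have hlam : 1 < lam (i + 2) := (ih (by omega)).trans_lt (h.ramIdx_mul_lam_lt (by omega))
    have hr : 2 ≤ ramIdx φ lam (i + 2) := h.two_le_ramIdx (by omega)
    exact one_le_mul_of_one_le_of_one_le (by exact_mod_cast one_le_two.trans hr) hlam.le

lemma two_lt_natDegree_mul_lam (hi : i + 1 < n) :
    2 < (φ (i + 2)).natDegree * lam (i + 2) := by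
  have hlt := h.natDegree_lt i (by omega)
  have hpos := h.natDegree_pos (i := i) (by omega)
  have htwo : (2 : ℚ) ≤ (φ (i + 2)).natDegree := by exact_mod_cast (by omega)
  linarith [mul_le_mul_of_nonneg_right htwo (h.lam_pos hi).le, h.one_lt_lam hi]

lemma chainBonus_nonneg (hi : i ≤ n) : 0 ≤ chainBonus φ lam i := by
  induction i with
  | zero => exact le_rfl
  | succ i ih =>
    have hr : (2 : ℚ) ≤ ramIdx φ lam (i + 1) := by exact_mod_cast h.two_le_ramIdx hi
    rw [chainBonus]
    exact add_nonneg (mul_nonneg (Nat.cast_nonneg _) (ih (by omega)))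
      (mul_nonneg (by linarith) (sub_nonneg.2 (h.one_le_ramIdx_mul hi)))

lemma bonusBound_lt_chainBonus (hi : i + 1 < n) (hr : 3 ≤ ramIdx φ lam (i + 2)) :
    bonusBound (ramIdx φ lam (i + 2)) ((φ (i + 2)).natDegree * lam (i + 2)) <
      chainBonus φ lam (i + 2) := by
  rw [chainBonus]
  exact lt_add_of_nonneg_of_lt (mul_nonneg (Nat.cast_nonneg _) (h.chainBonus_nonneg hi.le))
    (bonusBound_lt_of_three_le hr (h.two_lt_natDegree_mul_lam hi))

lemma bonusBound_le_chainBonus (hi : i + 1 < n) :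
    bonusBound (ramIdx φ lam (i + 2)) ((φ (i + 2)).natDegree * lam (i + 2)) ≤
      chainBonus φ lam (i + 2) := by
  rcases (h.two_le_ramIdx hi).eq_or_lt with hr | hr
  · rw [chainBonus_succ_of_ramIdx_eq_two hr.symm, ← hr, Nat.cast_ofNat]
    linarith [h.chainBonus_nonneg hi.le]
  · exact (h.bonusBound_lt_chainBonus hi hr).le

lemma chainBonus_pos (hi : i + 1 < n) : 0 < chainBonus φ lam (i + 2) := by
  have hx := h.two_lt_natDegree_mul_lam hi
  have hr : (2 : ℚ) ≤ ramIdx φ lam (i + 2) := by exact_mod_cast h.two_le_ramIdx hi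
  rw [chainBonus]
  refine add_pos_of_nonneg_of_pos
    (mul_nonneg (Nat.cast_nonneg _) (h.chainBonus_nonneg hi.le)) (mul_pos (by linarith) ?_)
  linarith [mul_le_mul_of_nonneg_right hr (by linarith : 0 ≤ (φ (i + 2)).natDegree * lam (i + 2))]

lemma eq_of_chainBonus_eq_bonusBound (hi : i + 1 < n)
    (heq : chainBonus φ lam (i + 2) =
      bonusBound (ramIdx φ lam (i + 2)) ((φ (i + 2)).natDegree * lam (i + 2))) :
    ramIdx φ lam (i + 2) = 2 ∧ i = 0 ∧ ramIdx φ lam 1 * lam 1 = 1 := by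
  have hr : ramIdx φ lam (i + 2) = 2 :=
    (not_lt.1 fun hr => (h.bonusBound_lt_chainBonus hi hr).ne heq.symm).antisymm
      (h.two_le_ramIdx hi)
  have hzero : chainBonus φ lam (i + 1) = 0 := by
    rw [chainBonus_succ_of_ramIdx_eq_two hr, hr, Nat.cast_ofNat] at heq
    linarith
  rcases i with _ | i
  · refine ⟨hr, rfl, ?_⟩
    have hr₁ : (2 : ℚ) ≤ ramIdx φ lam 1 := by exact_mod_cast h.two_le_ramIdx (i := 0) (by omega)
    rw [chainBonus, chainBonus, mul_zero, zero_add, zero_add, h.natDegree_one, Nat.cast_one,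
      one_mul] at hzero
    exact sub_eq_zero.1 ((mul_eq_zero.1 hzero).resolve_left (by linarith))
  · exact absurd hzero (h.chainBonus_pos (by omega)).ne'

end KeyChain

end Bound

end MacLane

theorem proposition7_general
    {O : Type*} [CommRing O] [IsDomain O] [IsDiscreteValuationRing O]
    [IsAlgClosed (IsLocalRing.ResidueField O)]
    {K : Type*} [Field K] [Algebra O K] [IsFractionRing O K]
    {L : Type*} [Field L] [Algebra K L] [Algebra.IsSeparable K L] [Normal K L]
    [Algebra O L] [IsScalarTower O K L]
    {w : AddValuation L (WithTop ℚ)} (hw : ∀ x : K, w (algebraMap K L x) = MacLane.ord O x)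
    {α : L} (hα : 0 < w α) {n : ℕ} (hn : 2 ≤ n) {φ : ℕ → K[X]} {lam : ℕ → ℚ}
    (hv : MacLane.IsMacLane O n φ lam)
    (hf : MacLane.IsProperKeyPoly O n φ lam (minpoly K α))
    {e : ℚ} (he : e = ((minpoly K α).natDegree : ℚ) / ((φ n).natDegree : ℚ)) :
    2 ≤ e ∧
    MacLane.bonusBound e ((φ n).natDegree * lam n) ≤ (MacLane.discBonus O K α : ℚ) ∧
    ((MacLane.discBonus O K α : ℚ) = MacLane.bonusBound e ((φ n).natDegree * lam n) →
      e = 2 ∧ n = 2 ∧ MacLane.IsEisenstein O (φ 2)) := by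
  obtain ⟨i, rfl⟩ := Nat.exists_eq_add_of_le' hn
  have hc := hv.keyChain (by omega) hf
  set ψ := Function.update φ (i + 3) (minpoly K α)
  have hψ : ψ (i + 3) = minpoly K α := Function.update_self ..
  have hψφ : ∀ j ≤ i + 2, ψ j = φ j := fun j hj => Function.update_of_ne (by omega) _ _
  have her : e = MacLane.ramIdx ψ lam (i + 2) := by
    have hpos := hc.natDegree_pos (i := i + 1) (by omega)
    rw [he, ← hψ, ← hψφ _ le_rfl, hc.natDegree_succ (i := i + 1) (by omega), Nat.cast_mul,
      mul_div_cancel_right₀ _ (Nat.cast_ne_zero.2 hpos.ne')]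
  have hbonus := hc.chainBonus_le_discBonus hw hψ
  rw [her, ← hψφ _ le_rfl, ← hψφ 2 (by omega)]
  have hbound := hc.bonusBound_le_chainBonus (i := i) (by omega)
  refine ⟨by exact_mod_cast hc.two_le_ramIdx (by omega), hbound.trans hbonus, fun heq => ?_⟩
  obtain ⟨hr, rfl, hlam⟩ :=
    hc.eq_of_chainBonus_eq_bonusBound (by omega) ((hbonus.trans heq.le).antisymm hbound)
  have hroot : aeval α (ψ (0 + 3)) = 0 := hψ ▸ minpoly.aeval K α
  exact ⟨by rw [hr, Nat.cast_ofNat], rfl, hc.isEisenstein_two hw hroot hα (by omega) hlam⟩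

theorem proposition7
    (O : Type*) [CommRing O] [IsDomain O] [IsDiscreteValuationRing O] [HenselianLocalRing O]
    [IsAlgClosed (IsLocalRing.ResidueField O)]
    (hchar : ringChar (IsLocalRing.ResidueField O) ≠ 2)
    (K : Type*) [Field K] [Algebra O K] [IsFractionRing O K]
    (Ksep : Type*) [Field Ksep] [Algebra K Ksep] [Algebra.IsSeparable K Ksep] [IsSepClosed Ksep]
    [Algebra O Ksep] [IsScalarTower O K Ksep]
    -- `w` is the extension of `ν_K` to the separable closure
    (w : AddValuation Ksep (WithTop ℚ))
    (hw : ∀ x : K, w (algebraMap K Ksep x) = MacLane.ord O x)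
    (α : Ksep) (hα : 0 < w α)
    (n : ℕ) (hn : 2 ≤ n) (φ : ℕ → K[X]) (lam : ℕ → ℚ)
    (hv : MacLane.IsMacLane O n φ lam)
    (hf : MacLane.IsProperKeyPoly O n φ lam (minpoly K α))
    (e : ℚ) (he : e = ((minpoly K α).natDegree : ℚ) / ((φ n).natDegree : ℚ)) :
    2 ≤ e ∧
    MacLane.bonusBound e ((φ n).natDegree * lam n) ≤ (MacLane.discBonus O K α : ℚ) ∧
    ((MacLane.discBonus O K α : ℚ) = MacLane.bonusBound e ((φ n).natDegree * lam n) →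
      e = 2 ∧ n = 2 ∧ MacLane.IsEisenstein O (φ 2)) := by
  have : IsSepClosure K Ksep := ⟨inferInstance, inferInstance⟩
  have : IsGalois K Ksep := inferInstance
  exact proposition7_general hw hα hn hv hf he
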